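/- Let $\mathcal Q\subset\mathbb R^2$ be bounded and convex with non-empty interior, let $\mathcal K=(\mathcal K^1,\dots,\mathcal K^m):\mathcal Q\to[0,\infty)^m$ be uniformly continuous (for closed $\mathcal Q$: continuous), and let the density to be covered be $\phi(q)=\mathcal K(q)^{\top}a$ with an unknown $a\in\mathbb R^m$ such that $a^j>a_{\min}>0$ for all $j$. Let $\beta$ be a lower bound of all admissible densities: $\mathcal K(q)^{\top}c\ge\beta$ for all $q\in\mathcal Q$ and all $c\in\mathbb R^m$ with $c^j\ge a_{\min}$ for all $j$. Let $0<\gamma\le\beta$, let $\sigma,d,k_1,k_2,k_3,\alpha>0$, and let $\Gamma$ be a diagonal matrix with positive diagonal entries. Consider $N$ differential-drive robots with positions $p_i\in\mathbb R^2$, orientations $\theta_i$ and inputs $v_i=(u_i,\omega_i)^{\top}$, so that $\dot p_i=S_iv_i$ and $\dot\theta_i=\omega_i$ with $$S_i=\begin{pmatrix}\cos\theta_i&-d\sin\theta_i\\ \sin\theta_i&d\cos\theta_i\end{pmatrix}.$$ Let $\mathcal V_i=\{q\in\mathcal Q:\|q-p_i\|\le\|q-p_j\|\ \forall j\ne i\}$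 be the Voronoi cells of the current positions. For the estimate $\hat a_i$ of $a$ by robot $i$ put $$\hat\lambda_i(q)=e^{-\|p_i-q\|^2/\sigma^2}\Big[\mathcal K(q)^{\top}\hat a_i-\gamma e^{-\|p_i-q\|^2/\sigma^2}\Big],\qquad \hat C^{\lambda}_{\mathcal V_i}=\frac{\int_{\mathcal V_i}q\,\hat\lambda_i(q)\,dq}{\int_{\mathcal V_i}\hat\lambda_i(q)\,dq}.$$ The robots use the control law $v_i=-k_1S_i^{-1}(p_i-\hat C^{\lambda}_{\mathcal V_i})$, the filters $$\dot\Lambda_i=-\alpha\Lambda_i+\mathcal K(p_i)\mathcal K(p_i)^{\top},\quad \dot\lambda_i=-\alpha\lambda_i+\mathcal K(p_i)\phi(p_i),\quad \Lambda_i(0)=0,\ \lambda_i(0)=0,$$ and the projected adaptation law $\dot{\hat a}_i=\Gamma(b_i-I_{\beta_i}b_i)$ with $$b_i=-k_2\int_{\mathcal V_i}e^{-\|p_i-q\|^2/\sigma^2}\mathcal K(q)(q-p_i)^{\top}dq\;S_iv_i-k_3(\Lambda_i\hat a_i-\lambda_i),$$ where $I_{\beta_i}$ is the diagonal matrix whose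 $j$-th diagonal entry is $0$ if $\hat a_i^j>a_{\min}$, or if $\hat a_i^j=a_{\min}$ and $b_i^j\ge0$, and is $1$ otherwise. Since the right-hand side of the adaptation law is discontinuous, that law is understood in the sense of Carathéodory ($\hat a_i$ is locally absolutely continuous and satisfies the law at almost every time). Then every solution of the closed loop on $[0,\infty)$ whose initial positions are pairwise distinct points of $\mathcal Q$ and whose initial estimates satisfy $\hat a_i^j(0)\ge a_{\min}$ has, with $\tilde a_i=\hat a_i-a$, the following properties for all $i=1,\dots,N$: 1. $\lim_{t\to\infty}\|p_i(t)-\hat C^{\lambda}_{\mathcal V_i}(t)\|=0$; 2. $\lim_{t\to\infty}\|v_i(t)\|=0$; 3. for every $T>0$, $\displaystyle\lim_{t\to\infty}\ \sup_{t-T<\tau<t}\big|\mathcal K(p_i(\tau))^{\top}\tilde a_i(t)\big|=0$. -/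

import Mathlib

open MeasureTheory Set Filter Topology
open scoped Matrix

noncomputable section

namespace AdaptiveCoverage

/-- The plane in which the robots move, with the Euclidean norm. -/
abbrev Plane := EuclideanSpace ℝ (Fin 2)

/-- The data of the adaptive coverage controller, for a density with `m` unknown parameters. -/
structure Controller (m : ℕ) where
  /-- the region to be covered -/
  Q : Set Plane
  /-- the vector of known basis functions -/
  K : Plane → Fin m → ℝ
  /-- the known lower bound on the unknown parameters -/
  amin : ℝ
  /-- the width of the Gaussian sensing function -/
  σ : ℝ
  /-- the weight of the aggregate agent density `γ * max_i f (‖p_i - q‖)` -/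
  γ : ℝ
  /-- the distance of the tracked point from the wheel axis -/
  d : ℝ
  /-- the gain of the control law -/
  k₁ : ℝ
  /-- the gain of the coverage term of the adaptation law -/
  k₂ : ℝ
  /-- the gain of the measurement term of the adaptation law -/
  k₃ : ℝ
  /-- the decay rate of the filters -/
  α : ℝ
  /-- the diagonal of the adaptation gain matrix `Γ` -/
  g : Fin m → ℝ

/-- The Voronoi cell of robot `i` in the region `Q`, for the configuration `P`. -/
def voronoiCell {N : ℕ} (Q : Set Plane) (P : Fin N → Plane) (i : Fin N) : Set Plane :=
  {q | q ∈ Q ∧ ∀ j, j ≠ i → ‖q - P i‖ ≤ ‖q - P j‖}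

/-- The matrix `S` of the robot model: `ṗ = S (u, ω)`. -/
def steeringMatrix (d θ : ℝ) : Matrix (Fin 2) (Fin 2) ℝ :=
  !![Real.cos θ, -d * Real.sin θ; Real.sin θ, d * Real.cos θ]

/-- The diagonal matrix `I_β` of the projection: the `j`-th diagonal entry is `0` if the estimate
`x j` lies above the bound `amin`, or on the bound with `b j ≥ 0`, and it is `1` otherwise. -/
def projectionMatrix {m : ℕ} (amin : ℝ) (x b : Fin m → ℝ) : Matrix (Fin m) (Fin m) ℝ :=
  open Classical in
  Matrix.diagonal fun j => if amin < x j ∨ (x j = amin ∧ 0 ≤ b j) then 0 else 1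

namespace Controller

variable {m N : ℕ} (D : Controller m)

/-- The density `q ↦ K(q)ᵀ c` with parameter vector `c`. -/
def density (c : Fin m → ℝ) (q : Plane) : ℝ := D.K q ⬝ᵥ c

/-- The Gaussian sensing function, as a function of the distance. -/
def sensing (x : ℝ) : ℝ := Real.exp (-(x ^ 2 / D.σ ^ 2))

/-- The modified density `λ_i`, formed with the parameter vector `c`, of a robot at `x`. -/
def modDensity (c : Fin m → ℝ) (x q : Plane) : ℝ :=
  D.sensing ‖x - q‖ * (D.density c q - D.γ * D.sensing ‖x - q‖)

/-- The mass of the modified density on the Voronoi cell of robot `i`. -/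
def mass (P : Fin N → Plane) (c : Fin m → ℝ) (i : Fin N) : ℝ :=
  ∫ q in voronoiCell D.Q P i, D.modDensity c (P i) q

/-- The first moment of the modified density on the Voronoi cell of robot `i`. -/
def moment (P : Fin N → Plane) (c : Fin m → ℝ) (i : Fin N) : Plane :=
  ∫ q in voronoiCell D.Q P i, D.modDensity c (P i) q • q

/-- The generalized centroid of the Voronoi cell of robot `i`, formed with the parameters `c`. -/
def centroid (P : Fin N → Plane) (c : Fin m → ℝ) (i : Fin N) : Plane :=
  (D.mass P c i)⁻¹ • D.moment P c i

/-- The matrix `∫_{V_i} exp(-‖p_i - q‖² / σ²) K(q) (q - p_i)ᵀ dq`. -/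
def couplingMatrix (P : Fin N → Plane) (i : Fin N) : Matrix (Fin m) (Fin 2) ℝ :=
  Matrix.of fun j l =>
    ∫ q in voronoiCell D.Q P i, D.sensing ‖P i - q‖ * D.K q j * (q l - P i l)

/-- The velocity `S (u, ω)` of the tracked point of a robot with orientation `θ` and input `v`. -/
def velocity (θ : ℝ) (v : EuclideanSpace ℝ (Fin 2)) : Plane :=
  WithLp.toLp 2 (steeringMatrix D.d θ *ᵥ WithLp.ofLp v)

/-- The control law `-k₁ S⁻¹ (p_i - Ĉ_i)`, where `c` is the current estimate of robot `i`. -/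
def control (P : Fin N → Plane) (θ : ℝ) (c : Fin m → ℝ) (i : Fin N) :
    EuclideanSpace ℝ (Fin 2) :=
  WithLp.toLp 2
    (-D.k₁ • ((steeringMatrix D.d θ)⁻¹ *ᵥ WithLp.ofLp (P i - D.centroid P c i)))

/-- The unprojected adaptation direction `b_i` of robot `i`, with orientation `θ`, input `v`,
estimate `c` and filter states `L`, `l`. -/
def adaptDir (P : Fin N → Plane) (i : Fin N) (θ : ℝ) (v : EuclideanSpace ℝ (Fin 2))
    (c : Fin m → ℝ) (L : Matrix (Fin m) (Fin m) ℝ) (l : Fin m → ℝ) : Fin m → ℝ :=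
  -D.k₂ • (D.couplingMatrix P i *ᵥ WithLp.ofLp (D.velocity θ v)) - D.k₃ • (L *ᵥ c - l)

/-- The right-hand side `Γ (b - I_β b)` of the adaptation law at the estimate `c`. -/
def adaptRate (c b : Fin m → ℝ) : Fin m → ℝ :=
  Matrix.diagonal D.g *ᵥ (b - projectionMatrix D.amin c b *ᵥ b)

/-- A trajectory on `[0, ∞)` of `N` differential-drive robots in closed loop with the adaptive
controller, when the true parameter vector is `a`: positions `p`, orientations `θ`, inputs
`v = (u, ω)`, filter states `L`, `l` and estimates `c`.  The right-hand side of the adaptation law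
is discontinuous, so the estimates solve it in the sense of Carathéodory: they are locally
absolutely continuous and satisfy it at almost every time. -/
structure IsTrajectory (a : Fin m → ℝ) (p : Fin N → ℝ → Plane) (θ : Fin N → ℝ → ℝ)
    (v : Fin N → ℝ → EuclideanSpace ℝ (Fin 2)) (L : Fin N → ℝ → Matrix (Fin m) (Fin m) ℝ)
    (l c : Fin N → ℝ → Fin m → ℝ) : Prop where
  position : ∀ i, ∀ t, 0 ≤ t →
    HasDerivWithinAt (p i) (D.velocity (θ i t) (v i t)) (Ici 0) t
  orientation : ∀ i, ∀ t, 0 ≤ t → HasDerivWithinAt (θ i) (v i t 1) (Ici 0) t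
  input : ∀ i, ∀ t, 0 ≤ t → v i t = D.control (fun k => p k t) (θ i t) (c i t) i
  filterMatrix_zero : ∀ i, L i 0 = 0
  filterMatrix : ∀ i j k, ∀ t, 0 ≤ t →
    HasDerivWithinAt (fun s => L i s j k)
      (-D.α * L i t j k + D.K (p i t) j * D.K (p i t) k) (Ici 0) t
  filterVector_zero : ∀ i, l i 0 = 0
  filterVector : ∀ i j, ∀ t, 0 ≤ t →
    HasDerivWithinAt (fun s => l i s j)
      (-D.α * l i t j + D.K (p i t) j * D.density a (p i t)) (Ici 0) t
  estimate_absCont : ∀ i j, ∀ t, 0 ≤ t →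
    AbsolutelyContinuousOnInterval (fun s => c i s j) 0 t
  estimate : ∀ i j, ∀ᵐ t : ℝ, 0 ≤ t →
    HasDerivAt (fun s => c i s j)
      (D.adaptRate (c i t)
        (D.adaptDir (fun k => p k t) i (θ i t) (v i t) (c i t) (L i t) (l i t)) j) t

end Controller

end AdaptiveCoverage

end

noncomputable section

namespace AdaptiveCoverage

/-! ### Comparison and monotonicity arguments on the half-line -/

section RealAnalysis

/-! The proof is a Lyapunov argument. Let S(q) be the largest sensing value of the robots at q, and
integrate σ²(γS²/2 − φS) over the region. Off the bisectors S is locally the Gaussian of the nearest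
robot, so the gradient of this cost in p_i is −2∫λ_i(q)(q − p_i)dq over the cell, without boundary
terms from the moving cells (`hasDerivAt_cost`). Add the squared parameter errors weighted by Γ⁻¹.
Replacing the true density by the estimated one in the gradient costs a term linear in the parameter
error (`inner_drift_sub_drift`), which the coverage part of the adaptation law cancels; the
measurement part contributes the quadratic form of Λ_i because λ_i = Λ_i a; and the projection only
helps, since a lies above the bound. So V' ≤ −Σ(k₁k₂ M_i‖p_i − C_i‖² + k₃ ã_iᵀΛ_i ã_i) almost
everywhere (`hasDerivAt_lyapunov_le`). Masses are positive because the density is at least γ, and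
Λ_i is positive semidefinite, so V decreases; it is bounded below, hence the dissipation must be
small somewhere in every late time window of fixed length.

Turning this into convergence needs uniform continuity in time, and continuity of the centroids is
available only at configurations of distinct sites. In finite time collisions are impossible:
bisectors separate the centroids, so mutual distances shrink at most exponentially
(`mem_closure_and_injective`). Asymptotic collisions are excluded by dissipation: near a colliding
configuration some robot of the cluster has a cell of definite area, whose centroid is pulled away
from the cluster, so the dissipation is bounded below (`exists_collision_bound`). Since positions
are Lipschitz in time, the trajectory ends up in a compact set of injective configurations
(`exists_compact_configurations`), where a Barbalat-type argument gives the first claim; the second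
follows as S_i⁻¹ is bounded.

For the third claim, ã_iᵀΛ_i ã_i → 0 by the same argument. Freeze x = ã_i(t): a large |K(p_i(τ))ᵀx|
at a recent τ stays large just before τ, and the filter remembers this, forcing xᵀΛ_i(t)x to be
bounded below (`quadForm_lower_bound`). -/

theorem absCont_sub_le {f : ℝ → ℝ} {s t κ : ℝ} (hst : s ≤ t)
    (hf : AbsolutelyContinuousOnInterval f s t)
    (h : ∀ᵐ x : ℝ, x ∈ Ioo s t → deriv f x ≤ κ) : f t - f s ≤ κ * (t - s) := by
  rw [← hf.integral_deriv_eq_sub]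
  have h1 : ∫ x in s..t, deriv f x ≤ ∫ _ in s..t, κ := by
    rw [intervalIntegral.integral_of_le hst, intervalIntegral.integral_of_le hst,
      integral_Ioc_eq_integral_Ioo, integral_Ioc_eq_integral_Ioo]
    refine setIntegral_mono_ae_restrict ?_ ?_ ?_
    · exact (hf.intervalIntegrable_deriv.1).mono_set Ioo_subset_Ioc_self
    · exact integrableOn_const (by simp)
    · exact (ae_restrict_iff' measurableSet_Ioo).2 h
  simpa [mul_comm] using h1

theorem absCont_abs_sub_le {f : ℝ → ℝ} {s t B : ℝ} (hst : s ≤ t)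
    (hf : AbsolutelyContinuousOnInterval f s t)
    (h : ∀ᵐ x : ℝ, x ∈ Ioo s t → |deriv f x| ≤ B) : |f t - f s| ≤ B * (t - s) := by
  rw [abs_le]
  constructor
  · have := absCont_sub_le (f := fun x => -f x) (κ := B) hst hf.neg (by
      filter_upwards [h] with x hx hxs
      rw [deriv.fun_neg]
      exact (neg_le_abs _).trans (hx hxs))
    linarith
  · exact absCont_sub_le hst hf (by
      filter_upwards [h] with x hx hxs using (le_abs_self _).trans (hx hxs))

theorem hasDerivAt_of_within_Ici {E : Type*} [NormedAddCommGroup E] [NormedSpace ℝ E]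
    {f : ℝ → E} {f' : E} {t : ℝ} (h : HasDerivWithinAt f f' (Ici 0) t) (ht : 0 < t) :
    HasDerivAt f f' t := h.hasDerivAt (Ici_mem_nhds ht)

/-- The integrating-factor form of Gronwall's inequality. It serves for separating functionals, for
mutual distances and for the quadratic form of the filter. -/
theorem monotoneOn_exp_mul {y y' : ℝ → ℝ} {a b k : ℝ} (ha : 0 ≤ a)
    (hy : ∀ t, 0 ≤ t → HasDerivWithinAt y (y' t) (Ici 0) t)
    (h : ∀ t ∈ Ioo a b, -k * y t ≤ y' t) :
    MonotoneOn (fun t => Real.exp (k * t) * y t) (Icc a b) := by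
  refine monotoneOn_of_hasDerivWithinAt_nonneg (convex_Icc a b)
    (f' := fun t => Real.exp (k * t) * (k * y t + y' t)) ?_ ?_ ?_
  · refine ContinuousOn.mul (by fun_prop) fun t ht => ?_
    exact (hy t (ha.trans ht.1)).continuousWithinAt.mono fun s hs => ha.trans hs.1
  · intro t ht
    rw [interior_Icc] at ht ⊢
    have h1 := hasDerivAt_of_within_Ici (hy t (ha.trans ht.1.le)) (ha.trans_lt ht.1)
    have h2 : HasDerivAt (fun t => Real.exp (k * t)) (Real.exp (k * t) * k) t := by
      simpa using ((hasDerivAt_id t).const_mul k).exp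
    exact ((h2.mul h1).congr_deriv (by ring)).hasDerivWithinAt
  · intro t ht
    rw [interior_Icc] at ht
    have := h t ht
    exact mul_nonneg (Real.exp_pos _).le (by linarith)

/-- Once V is within κ of its infimum, no later drop can reach κ. This replaces integrability of the
dissipation. -/
theorem exists_forall_sub_lt {V : ℝ → ℝ} {B η κ : ℝ} (hV : AntitoneOn V (Ici 0))
    (hB : ∀ t, 0 ≤ t → B ≤ V t) (hη : 0 ≤ η) (hκ : 0 < κ) :
    ∃ t₀, 0 ≤ t₀ ∧ ∀ t, t₀ ≤ t → V t - κ < V (t + η) := by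
  have hbdd : BddBelow (V '' Ici 0) := ⟨B, by rintro _ ⟨t, ht, rfl⟩; exact hB t ht⟩
  obtain ⟨_, ⟨t₀, ht₀, rfl⟩, h⟩ := exists_lt_of_csInf_lt (s := V '' Ici 0) ⟨_, 0, by simp, rfl⟩
    (lt_add_of_pos_right (sInf (V '' Ici 0)) hκ)
  refine ⟨t₀, ht₀, fun t ht => ?_⟩
  have h0 : (0:ℝ) ≤ t := le_trans ht₀ ht
  have h1 : sInf (V '' Ici 0) ≤ V (t + η) := csInf_le hbdd ⟨_, by simp; linarith, rfl⟩
  have h2 : V t ≤ V t₀ := hV ht₀ h0 ht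
  linarith

/-- Solutions of the stable scalar equation `y' = -α y + f` with `y 0 = 0` and `|f| ≤ B`. -/
theorem abs_le_of_filter {y f : ℝ → ℝ} {α B : ℝ} (hα : 0 < α) (h0 : y 0 = 0)
    (hy : ∀ t, 0 ≤ t → HasDerivWithinAt y (-α * y t + f t) (Ici 0) t)
    (hf : ∀ t, 0 ≤ t → |f t| ≤ B) {t : ℝ} (ht : 0 ≤ t) : |y t| ≤ B / α := by
  have key : ∀ (z g : ℝ → ℝ), z 0 = 0 →
      (∀ t, 0 ≤ t → HasDerivWithinAt z (-α * z t + g t) (Ici 0) t) →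
      (∀ t, 0 ≤ t → |g t| ≤ B) → -(B / α) ≤ z t := by
    intro z g hz0 hz hg
    have hm := monotoneOn_exp_mul (y := fun t => z t + B / α) (k := α) (a := 0) (b := t) le_rfl
      (fun t ht => (hz t ht).add_const _) (fun s hs => by
        have := (abs_le.1 (hg s hs.1.le)).1
        have h2 : α * (B / α) = B := by field_simp
        linarith)
    have h1 := hm (left_mem_Icc.2 ht) (right_mem_Icc.2 ht) ht
    have hB : 0 ≤ B := (abs_nonneg _).trans (hg 0 le_rfl)
    simp only [hz0, mul_zero, Real.exp_zero, zero_add, one_mul] at h1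
    have h3 : 0 ≤ z t + B / α :=
      nonneg_of_mul_nonneg_right (le_trans (by positivity) h1) (Real.exp_pos _)
    linarith
  rw [abs_le]
  refine ⟨key y f h0 hy hf, ?_⟩
  have := key (fun t => -y t) (fun t => -f t) (by simp [h0])
    (fun t ht => ((hy t ht).neg).congr_deriv (by ring)) (fun t ht => by simpa using hf t ht)
  linarith

/-- An absolutely continuous function that is stationary below a level never crosses it. -/
theorem le_of_stationary_below {f : ℝ → ℝ} {r : ℝ}
    (hf : ∀ t, 0 ≤ t → AbsolutelyContinuousOnInterval f 0 t)
    (h : ∀ᵐ t : ℝ, 0 ≤ t → f t < r → HasDerivAt f 0 t) (h0 : r ≤ f 0) {t : ℝ} (ht : 0 ≤ t) :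
    r ≤ f t := by
  by_contra hlt
  push Not at hlt
  have hc : ContinuousOn f (Icc 0 t) := by
    simpa [uIcc_of_le ht] using (hf t ht).continuousOn
  set A := {s | s ∈ Icc 0 t ∧ r ≤ f s} with hA
  have hAc : IsClosed A := by
    have := hc.preimage_isClosed_of_isClosed isClosed_Icc (isClosed_Ici (a := r))
    exact this
  have hAn : A.Nonempty := ⟨0, ⟨le_rfl, ht⟩, h0⟩
  have hAb : BddAbove A := ⟨t, fun s hs => hs.1.2⟩
  have hs := hAc.csSup_mem hAn hAb
  -- The last time at which f is at least r: after it f is below r, hence has zero derivative almost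
  -- everywhere and stays equal to f s.
  set s := sSup A
  have hst : s ≤ t := hs.1.2
  have hAC : AbsolutelyContinuousOnInterval f s t := (hf t ht).mono (by
    rw [uIcc_of_le hst, uIcc_of_le ht]
    exact Icc_subset_Icc_left hs.1.1)
  have := absCont_abs_sub_le (B := 0) hst hAC (by
    filter_upwards [h] with x hx hxs
    have hx0 : 0 ≤ x := hs.1.1.trans hxs.1.le
    have hxr : f x < r := by
      by_contra hcon
      push Not at hcon
      exact absurd (le_csSup hAb (show x ∈ A from ⟨⟨hx0, hxs.2.le⟩, hcon⟩)) (not_le.2 hxs.1)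
    rw [(hx hx0 hxr).deriv]
    simp)
  have h2 := abs_nonpos_iff.1 (this.trans (by simp))
  linarith [hs.2]

end RealAnalysis

/-! ### Voronoi cells: measurability, bisectors, strips -/

section VoronoiCells

/-- The Voronoi cell of site `i` in the whole plane. -/
def nearestRegion {N : ℕ} (P : Fin N → Plane) (i : Fin N) : Set Plane :=
  {q | ∀ j, j ≠ i → ‖q - P i‖ ≤ ‖q - P j‖}

variable {N : ℕ}

theorem isClosed_nearestRegion (P : Fin N → Plane) (i : Fin N) :
    IsClosed (nearestRegion P i) := by
  simp only [nearestRegion, ofPred_forall]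
  exact isClosed_iInter fun j => isClosed_iInter fun _ =>
    isClosed_le (by fun_prop) (by fun_prop)

theorem measurableSet_nearestRegion (P : Fin N → Plane) (i : Fin N) :
    MeasurableSet (nearestRegion P i) := (isClosed_nearestRegion P i).measurableSet

theorem voronoiCell_eq_inter (Q : Set Plane) (P : Fin N → Plane) (i : Fin N) :
    voronoiCell Q P i = nearestRegion P i ∩ Q := by
  ext q; simp [voronoiCell, nearestRegion, and_comm]

/-- The region is not assumed measurable. Restricting to it first leaves only the closed set
`nearestRegion P i` to integrate over. -/
theorem restrict_voronoiCell (Q : Set Plane) (P : Fin N → Plane) (i : Fin N) :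
    volume.restrict (voronoiCell Q P i) = (volume.restrict Q).restrict (nearestRegion P i) := by
  rw [voronoiCell_eq_inter, Measure.restrict_restrict (measurableSet_nearestRegion P i)]

theorem volume_bisector_eq_zero {x y : Plane} (h : x ≠ y) :
    volume {q : Plane | ‖q - x‖ = ‖q - y‖} = 0 := by
  have h1 : {q : Plane | ‖q - x‖ = ‖q - y‖} = (AffineSubspace.perpBisector x y : Set Plane) := by
    ext q
    simp [AffineSubspace.mem_perpBisector_iff_dist_eq, dist_eq_norm]
  rw [h1]
  exact Measure.addHaar_affineSubspace _ _ (by simpa using h)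

theorem ae_norm_sub_ne {P : Fin N → Plane} (hP : Function.Injective P) (Q : Set Plane) :
    ∀ᵐ q ∂(volume.restrict Q), ∀ i j, i ≠ j → ‖q - P i‖ ≠ ‖q - P j‖ := by
  refine ae_restrict_of_ae ?_
  rw [ae_all_iff]; intro i
  rw [ae_all_iff]; intro j
  by_cases hij : i = j
  · simp [hij]
  · have := volume_bisector_eq_zero (hP.ne hij)
    filter_upwards [measure_eq_zero_iff_ae_notMem.1 this] with q hq _ using hq

theorem exists_mem_nearestRegion (P : Fin N → Plane) (i : Fin N) (q : Plane) :
    ∃ j, q ∈ nearestRegion P j := by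
  have : Nonempty (Fin N) := ⟨i⟩
  obtain ⟨j, hj⟩ := Finite.exists_min (fun j => ‖q - P j‖)
  exact ⟨j, fun k _ => hj k⟩

/-- Off the bisectors, membership in a cell is locally constant in the sites. -/
theorem eventually_mem_nearestRegion_iff {Z : Type*} [TopologicalSpace Z] {P : Z → Fin N → Plane}
    {z₀ : Z} (hP : ContinuousAt P z₀) {q : Plane}
    (hq : ∀ i j, i ≠ j → ‖q - P z₀ i‖ ≠ ‖q - P z₀ j‖) (i : Fin N) :
    ∀ᶠ z in 𝓝 z₀, (q ∈ nearestRegion (P z) i ↔ q ∈ nearestRegion (P z₀) i) := by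
  have hc : ∀ k, ContinuousAt (fun z => ‖q - P z k‖) z₀ := fun k =>
    (continuousAt_const.sub ((continuous_apply k).continuousAt.comp hP)).norm
  by_cases hi : q ∈ nearestRegion (P z₀) i
  · have : ∀ᶠ z in 𝓝 z₀, ∀ j, j ≠ i → ‖q - P z i‖ < ‖q - P z j‖ := by
      rw [eventually_all]
      intro j
      by_cases hj : j = i
      · simp [hj]
      · have := (hc i).eventually_lt (hc j) (lt_of_le_of_ne (hi j hj) (hq i j (Ne.symm hj)))
        filter_upwards [this] with z hz _ using hz
    filter_upwards [this] with z hz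
    exact iff_of_true (fun j hj => (hz j hj).le) hi
  · have hi' := hi
    simp only [nearestRegion, mem_ofPred_eq, not_forall, not_le] at hi'
    obtain ⟨j, hj, hlt⟩ := hi'
    filter_upwards [(hc j).eventually_lt (hc i) hlt] with z hz
    exact iff_of_false (fun h => absurd (h j hj) (not_le.2 hz)) hi

/-- The cell lies on its own side of the bisector. Written as an affine inequality in q, this passes
to weighted averages, in particular to centroids. -/
theorem inner_midpoint_nonneg {P : Fin N → Plane} {i j : Fin N} (hij : j ≠ i) {q : Plane}
    (hq : q ∈ nearestRegion P i) : ‖P i - P j‖ ^ 2 ≤ 2 * inner ℝ (P i - P j) (q - P j) := by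
  have h1 := hq j hij
  have h2 : q - P i = (q - P j) - (P i - P j) := by abel
  have h3 : ‖q - P i‖ ^ 2 ≤ ‖q - P j‖ ^ 2 := by gcongr
  rw [h2, norm_sub_sq_real] at h3
  rw [real_inner_comm]
  linarith

/-- Strips meet a bounded set in uniformly small area. -/
theorem exists_strip_volume_le {Q : Set Plane} (hQ : Bornology.IsBounded Q) {ε : ENNReal}
    (hε : 0 < ε) : ∃ s : ℝ, 0 < s ∧ ∀ u x : Plane, ‖u‖ = 1 →
      volume (Q ∩ {q | |inner ℝ u (q - x)| ≤ s}) ≤ ε := by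
  obtain ⟨R, hR⟩ := hQ.subset_closedBall 0
  have hV : volume (Metric.closedBall (0 : Plane) (R + 1)) ≠ ⊤ := measure_closedBall_lt_top.ne
  obtain ⟨n, hn⟩ := ENNReal.exists_nat_mul_gt hε.ne' hV
  -- A packing argument: translates by multiples of 3s along u of a strip of width 2s are disjoint,
  -- and n of them shift by at most 1, so they fit in the ball of radius R + 1, whose volume is less
  -- than nε.
  refine ⟨1 / (3 * (n + 1)), by positivity, fun u x hu => ?_⟩
  set s : ℝ := 1 / (3 * (n + 1)) with hs
  have hs0 : 0 < s := by positivity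
  set A : Set Plane := Metric.closedBall 0 R ∩ {q | |inner ℝ u (q - x)| ≤ s} with hA
  have hAm : MeasurableSet A := by
    refine (Metric.isClosed_closedBall.inter (isClosed_le ?_ continuous_const)).measurableSet
    fun_prop
  refine (measure_mono (inter_subset_inter_left _ hR)).trans ?_
  let B : ℕ → Set Plane := fun k => (fun q => q + (-(3 * s * k)) • u) ⁻¹' A
  have hB : ∀ k, volume (B k) = volume A := fun k => measure_preimage_add_right _ _ _
  have hBm : ∀ k, MeasurableSet (B k) := fun k => hAm.preimage (by fun_prop)
  have hBin : ∀ k, ∀ q ∈ B k, |inner ℝ u (q - x) - 3 * s * k| ≤ s := by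
    intro k q hq
    have := hq.2
    simp only [mem_ofPred_eq] at this
    rw [show q + (-(3 * s * k)) • u - x = (q - x) + (-(3 * s * k)) • u by abel, inner_add_right,
      inner_smul_right, real_inner_self_eq_norm_sq, hu] at this
    convert this using 2
    ring
  have hdisj : Set.PairwiseDisjoint (↑(Finset.range n)) B := by
    intro k _ l _ hkl
    refine Set.disjoint_left.2 fun q hk hl => hkl ?_
    have h1 := abs_le.1 (hBin k q hk)
    have h2 := abs_le.1 (hBin l q hl)
    have h3 : (k : ℝ) < l + 1 := by
      by_contra hcon
      push Not at hcon
      nlinarith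
    have h4 : (l : ℝ) < k + 1 := by
      by_contra hcon
      push Not at hcon
      nlinarith
    have h5 : k < l + 1 := by exact_mod_cast h3
    have h6 : l < k + 1 := by exact_mod_cast h4
    omega
  have hsub : (⋃ k ∈ Finset.range n, B k) ⊆ Metric.closedBall (0 : Plane) (R + 1) := by
    intro q hq
    simp only [mem_iUnion, Finset.mem_range] at hq
    obtain ⟨k, hk, hq⟩ := hq
    have h1 : ‖q + (-(3 * s * k)) • u‖ ≤ R := by simpa using hq.1
    have h2 : ‖(3 * s * k) • u‖ ≤ 1 := by
      rw [norm_smul, hu, mul_one, Real.norm_of_nonneg (by positivity)]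
      have : (k : ℝ) ≤ n + 1 := by
        have : (k : ℝ) < n := by exact_mod_cast hk
        linarith
      calc 3 * s * k ≤ 3 * s * (n + 1) := by gcongr
        _ = 1 := by rw [hs]; field_simp
    rw [mem_closedBall_zero_iff]
    calc ‖q‖ = ‖(q + (-(3 * s * k)) • u) + (3 * s * k) • u‖ := by congr 1; module
      _ ≤ _ := norm_add_le _ _
      _ ≤ R + 1 := by linarith
  have hsum : (n : ENNReal) * volume A ≤ volume (Metric.closedBall (0 : Plane) (R + 1)) := by
    calc (n : ENNReal) * volume A = ∑ k ∈ Finset.range n, volume (B k) := by simp [hB]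
      _ = volume (⋃ k ∈ Finset.range n, B k) :=
        (measure_biUnion_finset hdisj fun k _ => hBm k).symm
      _ ≤ _ := measure_mono hsub
  by_contra hcon
  push Not at hcon
  have : (n : ENNReal) * ε ≤ n * volume A := by gcongr
  exact absurd (hn.trans_le (this.trans hsum)) (lt_irrefl _)

end VoronoiCells

/-! ### Integrals over cells, masses and centroids -/

namespace Controller

variable {m N : ℕ} {D : Controller m}

/-- The standing assumptions on the region, the basis functions and the controller constants. -/
structure Regular (D : Controller m) : Prop where
  convex : Convex ℝ D.Q
  bounded : Bornology.IsBounded D.Q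
  interior_nonempty : (interior D.Q).Nonempty
  cont : UniformContinuousOn D.K D.Q
  γ_pos : 0 < D.γ
  σ_pos : 0 < D.σ
  density_lb : ∀ c : Fin m → ℝ, (∀ j, D.amin ≤ c j) → ∀ q ∈ D.Q, D.γ ≤ D.density c q

/-- Lebesgue measure on the region. -/
abbrev area (D : Controller m) : Measure Plane := volume.restrict D.Q

namespace Regular

variable (hD : D.Regular)
include hD

theorem isFiniteMeasure : IsFiniteMeasure D.area :=
  ⟨by rw [Measure.restrict_apply_univ]; exact hD.bounded.measure_lt_top⟩

theorem ae_mem : ∀ᵐ q ∂D.area, q ∈ D.Q :=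
  ae_restrict_mem₀ (hD.convex.nullMeasurableSet (μ := volume))

theorem ae_mem_interior : ∀ᵐ q ∂D.area, q ∈ interior D.Q := by
  have h1 : volume (frontier D.Q) = 0 := hD.convex.addHaar_frontier volume
  filter_upwards [hD.ae_mem, ae_restrict_of_ae (measure_eq_zero_iff_ae_notMem.1 h1)] with q hq hq'
  by_contra h
  exact hq' ⟨subset_closure hq, h⟩

/-- A convex set differs from its interior by a null set, and on the open interior continuity gives
measurability. -/
theorem aestronglyMeasurable {E : Type*} [NormedAddCommGroup E] {f : Plane → E}
    (hf : ContinuousOn f D.Q) : AEStronglyMeasurable f D.area := by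
  have h1 : D.area = volume.restrict (interior D.Q) := by
    refine Measure.restrict_congr_set ?_
    exact (interior_ae_eq_of_null_frontier (hD.convex.addHaar_frontier volume)).symm
  rw [h1]
  exact (hf.mono interior_subset).aestronglyMeasurable isOpen_interior.measurableSet

theorem integrable {E : Type*} [NormedAddCommGroup E] {f : Plane → E} {C : ℝ}
    (hf : ContinuousOn f D.Q) (hC : ∀ q ∈ D.Q, ‖f q‖ ≤ C) : Integrable f D.area := by
  have := hD.isFiniteMeasure
  refine Integrable.of_bound (hD.aestronglyMeasurable hf) C ?_
  filter_upwards [hD.ae_mem] with q hq using hC q hq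

/-- The region need not be closed, so compactness is unavailable; but a uniformly continuous map
sends a totally bounded set to a totally bounded one. -/
theorem exists_basis_bound : ∃ B, 0 < B ∧ ∀ q ∈ D.Q, ∀ j, |D.K q j| ≤ B := by
  have h1 : UniformContinuous (D.Q.domRestrict D.K) := uniformContinuousOn_iff_restrict.1 hD.cont
  have h2 : TotallyBounded (univ : Set D.Q) := by
    rw [← totallyBounded_image_iff (isUniformInducing_iff_uniformSpace.2 rfl :
      IsUniformInducing (Subtype.val : D.Q → Plane))]
    simpa using hD.bounded.isCompact_closure.totallyBounded.subset subset_closure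
  have h3 := (h2.image h1).isBounded
  obtain ⟨B, hB⟩ := h3.exists_norm_le
  refine ⟨max B 1, by positivity, fun q hq j => ?_⟩
  have := hB (D.K q) ⟨⟨q, hq⟩, trivial, rfl⟩
  exact ((norm_le_pi_norm (D.K q) j).trans this).trans (le_max_left _ _)

theorem continuousOn_basis (j : Fin m) : ContinuousOn (fun q => D.K q j) D.Q :=
  (continuous_apply j).comp_continuousOn hD.cont.continuousOn

theorem continuousOn_density (c : Fin m → ℝ) : ContinuousOn (D.density c) D.Q := by
  unfold density dotProduct
  exact continuousOn_finsetSum _ fun j _ => (hD.continuousOn_basis j).mul continuousOn_const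

theorem exists_density_bound : ∃ B, 0 < B ∧
    ∀ c q, q ∈ D.Q → |D.density c q| ≤ B * ‖c‖ := by
  obtain ⟨B, hB, h⟩ := hD.exists_basis_bound
  -- The factor m + 1 instead of m keeps the constant positive when m = 0.
  refine ⟨(m + 1) * B, by positivity, fun c q hq => ?_⟩
  unfold density dotProduct
  calc |∑ j, D.K q j * c j| ≤ ∑ j, |D.K q j * c j| := Finset.abs_sum_le_sum_abs _ _
    _ ≤ ∑ _j : Fin m, B * ‖c‖ := by
      refine Finset.sum_le_sum fun j _ => ?_
      rw [abs_mul]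
      exact mul_le_mul (h q hq j) (norm_le_pi_norm c j) (abs_nonneg _) hB.le
    _ = m * (B * ‖c‖) := by simp
    _ ≤ (m + 1) * B * ‖c‖ := by nlinarith [mul_nonneg hB.le (norm_nonneg c)]

end Regular

theorem sensing_pos (x : ℝ) : 0 < D.sensing x := Real.exp_pos _

theorem sensing_le_one (x : ℝ) : D.sensing x ≤ 1 := by
  rw [sensing, Real.exp_le_one_iff]
  have : 0 ≤ x ^ 2 / D.σ ^ 2 := by positivity
  linarith

theorem continuous_sensing : Continuous D.sensing := by
  unfold sensing; fun_prop

theorem continuous_sensing_left (x : Plane) : Continuous fun q : Plane => D.sensing ‖x - q‖ :=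
  continuous_sensing.comp (by fun_prop)

theorem Regular.sensing_lt_one (hD : D.Regular) {x : ℝ} (hx : x ≠ 0) : D.sensing x < 1 := by
  rw [sensing, Real.exp_lt_one_iff]
  have h1 := hD.σ_pos
  have : 0 < x ^ 2 / D.σ ^ 2 := by positivity
  linarith

theorem density_sub (c a : Fin m → ℝ) (q : Plane) :
    D.density (c - a) q = D.density c q - D.density a q := by
  simp [density, dotProduct_sub]

/-- The integral `∫_{V_i} λ_i(q) (q - p_i) dq`. -/
def drift (D : Controller m) (P : Fin N → Plane) (c : Fin m → ℝ) (i : Fin N) : Plane :=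
  ∫ q in nearestRegion P i, D.modDensity c (P i) q • (q - P i) ∂D.area

theorem mass_eq (P : Fin N → Plane) (c : Fin m → ℝ) (i : Fin N) :
    D.mass P c i = ∫ q in nearestRegion P i, D.modDensity c (P i) q ∂D.area := by
  rw [mass, restrict_voronoiCell]

theorem moment_eq (P : Fin N → Plane) (c : Fin m → ℝ) (i : Fin N) :
    D.moment P c i = ∫ q in nearestRegion P i, D.modDensity c (P i) q • q ∂D.area := by
  rw [moment, restrict_voronoiCell]

theorem couplingMatrix_eq (P : Fin N → Plane) (i : Fin N) (j : Fin m) (l : Fin 2) :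
    D.couplingMatrix P i j l =
      ∫ q in nearestRegion P i, D.sensing ‖P i - q‖ * D.K q j * (q l - P i l) ∂D.area := by
  rw [couplingMatrix, Matrix.of_apply, restrict_voronoiCell]

namespace Regular

variable (hD : D.Regular)
include hD

theorem exists_norm_bound : ∃ R, 0 < R ∧ ∀ q ∈ closure D.Q, ‖q‖ ≤ R := by
  obtain ⟨R, hR⟩ := hD.bounded.closure.exists_norm_le
  exact ⟨max R 1, by positivity, fun q hq => (hR q hq).trans (le_max_left _ _)⟩

/-- Dominated convergence: for distinct sites almost every q avoids all bisectors, and there the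
indicator of the moving cell is locally constant. -/
theorem continuousAt_cellIntegral {Z : Type*} [TopologicalSpace Z] [FirstCountableTopology Z]
    {E : Type*} [NormedAddCommGroup E] [NormedSpace ℝ E] {P : Z → Fin N → Plane}
    {f : Z → Plane → E} {z₀ : Z} {C : ℝ} (hP : ContinuousAt P z₀)
    (hinj : Function.Injective (P z₀)) (hf : ∀ z, ContinuousOn (f z) D.Q)
    (hb : ∀ᶠ z in 𝓝 z₀, ∀ q ∈ D.Q, ‖f z q‖ ≤ C)
    (hc : ∀ q ∈ D.Q, ContinuousAt (fun z => f z q) z₀) (i : Fin N) :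
    ContinuousAt (fun z => ∫ q in nearestRegion (P z) i, f z q ∂D.area) z₀ := by
  have := hD.isFiniteMeasure
  simp_rw [← integral_indicator (measurableSet_nearestRegion _ i)]
  refine continuousAt_of_dominated (bound := fun _ => C) ?_ ?_ (integrable_const C) ?_
  · exact Eventually.of_forall fun z =>
      (hD.aestronglyMeasurable (hf z)).indicator (measurableSet_nearestRegion _ i)
  · filter_upwards [hb] with z hz
    filter_upwards [hD.ae_mem] with q hq
    exact (norm_indicator_le_norm_self _ _).trans (hz q hq)
  · filter_upwards [hD.ae_mem, ae_norm_sub_ne hinj D.Q] with q hq hne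
    have h1 := eventually_mem_nearestRegion_iff hP hne i
    by_cases hmem : q ∈ nearestRegion (P z₀) i
    · refine (hc q hq).congr ?_
      filter_upwards [h1] with z hz
      rw [indicator_of_mem (hz.2 hmem)]
    · refine continuousAt_const (y := (0 : E)) |>.congr ?_
      filter_upwards [h1] with z hz
      rw [indicator_of_notMem (fun h => hmem (hz.1 h))]

omit hD in
theorem area_pos_of_mem {P : Fin N → Plane} {i : Fin N} {q₀ : Plane}
    (hq₀ : q₀ ∈ interior D.Q) (h : ∀ j, j ≠ i → ‖q₀ - P i‖ < ‖q₀ - P j‖) :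
    0 < D.area (nearestRegion P i) := by
  rw [Measure.restrict_apply (measurableSet_nearestRegion P i)]
  let U : Set Plane := {q | ∀ j, j ≠ i → ‖q - P i‖ < ‖q - P j‖} ∩ interior D.Q
  have hU : IsOpen U := by
    refine IsOpen.inter ?_ isOpen_interior
    simp only [ofPred_forall]
    exact isOpen_iInter_of_finite fun j => isOpen_iInter_of_finite fun _ =>
      isOpen_lt (by fun_prop) (by fun_prop)
  refine (hU.measure_pos volume ⟨q₀, h, hq₀⟩).trans_le (measure_mono ?_)
  exact inter_subset_inter (fun q hq j hj => (hq j hj).le) interior_subset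

theorem exists_mem_interior {x : Plane} (hx : x ∈ closure D.Q) {U : Set Plane} (hU : IsOpen U)
    (hxU : x ∈ U) : ∃ q ∈ interior D.Q, q ∈ U := by
  rw [← hD.convex.closure_interior_eq_closure_of_nonempty_interior hD.interior_nonempty] at hx
  obtain ⟨q, hq, hq'⟩ := mem_closure_iff.1 hx U hU hxU
  exact ⟨q, hq', hq⟩

/-- Points strictly nearest to a site form an open neighbourhood of that site, which meets the
interior even if the site is on the boundary. A fixed such point survives small perturbations of the
sites. -/
theorem eventually_area_pos {P₀ : Fin N → Plane} (hP : ∀ i, P₀ i ∈ closure D.Q)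
    (hinj : Function.Injective P₀) :
    ∀ᶠ P in 𝓝 P₀, ∀ i, 0 < D.area (nearestRegion P i) := by
  rw [eventually_all]
  intro i
  have hU : IsOpen {q : Plane | ∀ j, j ≠ i → ‖q - P₀ i‖ < ‖q - P₀ j‖} := by
    simp only [ofPred_forall]
    exact isOpen_iInter_of_finite fun j => isOpen_iInter_of_finite fun _ =>
      isOpen_lt (by fun_prop) (by fun_prop)
  obtain ⟨q, hq, hqU⟩ := hD.exists_mem_interior (hP i) hU (by
    intro j hj
    simpa [sub_eq_zero] using hinj.ne hj.symm)
  have hO : IsOpen {P : Fin N → Plane | ∀ j, j ≠ i → ‖q - P i‖ < ‖q - P j‖} := by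
    simp only [ofPred_forall]
    exact isOpen_iInter_of_finite fun j => isOpen_iInter_of_finite fun _ =>
      isOpen_lt (by fun_prop) (by fun_prop)
  filter_upwards [hO.mem_nhds hqU] with P hPq
  exact area_pos_of_mem hq hPq

theorem area_pos {P : Fin N → Plane} (hP : ∀ i, P i ∈ closure D.Q)
    (hinj : Function.Injective P) (i : Fin N) : 0 < D.area (nearestRegion P i) :=
  (hD.eventually_area_pos hP hinj).self_of_nhds i

theorem continuousOn_modDensity (c : Fin m → ℝ) (x : Plane) :
    ContinuousOn (D.modDensity c x) D.Q := by
  unfold modDensity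
  exact (continuous_sensing_left x).continuousOn.mul ((hD.continuousOn_density c).sub
    (continuous_const.mul (continuous_sensing_left x)).continuousOn)

theorem exists_modDensity_bound : ∃ B, 0 < B ∧
    ∀ c x q, q ∈ D.Q → |D.modDensity c x q| ≤ B * (‖c‖ + 1) := by
  obtain ⟨B, hB, h⟩ := hD.exists_density_bound
  have hγ := hD.γ_pos
  refine ⟨B + D.γ, by positivity, fun c x q hq => ?_⟩
  have h1 := h c q hq
  have h2 : |D.γ * D.sensing ‖x - q‖| ≤ D.γ := by
    rw [abs_of_pos (mul_pos hγ (sensing_pos _))]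
    exact mul_le_of_le_one_right hγ.le (sensing_le_one _)
  rw [modDensity, abs_mul, abs_of_pos (sensing_pos _)]
  calc _ ≤ 1 * |D.density c q - D.γ * D.sensing ‖x - q‖| := by
        gcongr; exact sensing_le_one _
    _ ≤ B * ‖c‖ + D.γ := by rw [one_mul]; exact (abs_sub _ _).trans (add_le_add h1 h2)
    _ ≤ _ := by nlinarith [norm_nonneg c, mul_nonneg hγ.le (norm_nonneg c)]

/-- This is where the density bound by γ enters: the aggregate term never exceeds the density, and
the bound vanishes only at q = x. -/
theorem le_modDensity {c : Fin m → ℝ} (hc : ∀ j, D.amin ≤ c j) (x : Plane) {q : Plane}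
    (hq : q ∈ D.Q) :
    D.γ * (D.sensing ‖x - q‖ * (1 - D.sensing ‖x - q‖)) ≤ D.modDensity c x q := by
  rw [modDensity]
  have h1 := hD.density_lb c hc q hq
  have h2 := sensing_pos (D := D) ‖x - q‖
  nlinarith [mul_le_mul_of_nonneg_left h1 h2.le]

theorem modDensity_nonneg {c : Fin m → ℝ} (hc : ∀ j, D.amin ≤ c j) (x : Plane) {q : Plane}
    (hq : q ∈ D.Q) : 0 ≤ D.modDensity c x q := by
  refine le_trans ?_ (hD.le_modDensity hc x hq)
  have := sensing_le_one (D := D) ‖x - q‖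
  exact mul_nonneg hD.γ_pos.le (mul_nonneg (sensing_pos _).le (by linarith))

theorem ae_modDensity_pos {c : Fin m → ℝ} (hc : ∀ j, D.amin ≤ c j) (x : Plane) :
    ∀ᵐ q ∂D.area, 0 < D.modDensity c x q := by
  have h1 : ∀ᵐ q ∂D.area, q ≠ x :=
    ae_restrict_of_ae (measure_eq_zero_iff_ae_notMem.1 (measure_singleton x))
  filter_upwards [hD.ae_mem, h1] with q hq hne
  refine lt_of_lt_of_le ?_ (hD.le_modDensity hc x hq)
  have := hD.sensing_lt_one (x := ‖x - q‖) (by simpa [sub_eq_zero] using hne.symm)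
  exact mul_pos hD.γ_pos (mul_pos (sensing_pos _) (by linarith))

theorem integrable_modDensity (c : Fin m → ℝ) (x : Plane) :
    Integrable (D.modDensity c x) D.area := by
  obtain ⟨B, -, h⟩ := hD.exists_modDensity_bound
  exact hD.integrable (hD.continuousOn_modDensity c x) (fun q hq => h c x q hq)

theorem integrable_modDensity_smul {E : Type*} [NormedAddCommGroup E] [NormedSpace ℝ E]
    (c : Fin m → ℝ) (x : Plane) {f : Plane → E} (hf : Continuous f) :
    Integrable (fun q => D.modDensity c x q • f q) D.area := by
  obtain ⟨B, hB, h⟩ := hD.exists_modDensity_bound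
  obtain ⟨C, hC⟩ := hD.bounded.isCompact_closure.exists_bound_of_continuousOn hf.continuousOn
  refine hD.integrable (C := B * (‖c‖ + 1) * C)
    ((hD.continuousOn_modDensity c x).smul hf.continuousOn) (fun q hq => ?_)
  rw [norm_smul]
  exact mul_le_mul (h c x q hq) (hC q (subset_closure hq)) (norm_nonneg _) (by positivity)

omit hD in
theorem cellIntegral_pos {P : Fin N → Plane} {i : Fin N} (hA : 0 < D.area (nearestRegion P i))
    {f : Plane → ℝ} (hf : Integrable f D.area) (h : ∀ᵐ q ∂D.area, 0 < f q) :
    0 < ∫ q in nearestRegion P i, f q ∂D.area := by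
  rw [setIntegral_pos_iff_support_of_nonneg_ae
    (ae_restrict_of_ae (h.mono fun q hq => hq.le)) hf.integrableOn]
  have : (Function.support f ∩ nearestRegion P i : Set Plane) =ᵐ[D.area] nearestRegion P i := by
    filter_upwards [h] with q hq
    exact propext ⟨fun h => h.2, fun h => ⟨hq.ne', h⟩⟩
  rwa [measure_congr this]

theorem mass_pos {P : Fin N → Plane} {i : Fin N} (hA : 0 < D.area (nearestRegion P i))
    {c : Fin m → ℝ} (hc : ∀ j, D.amin ≤ c j) : 0 < D.mass P c i := by
  rw [mass_eq]
  exact cellIntegral_pos hA (hD.integrable_modDensity c _) (hD.ae_modDensity_pos hc _)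

theorem drift_eq {P : Fin N → Plane} {c : Fin m → ℝ} {i : Fin N} (h : D.mass P c i ≠ 0) :
    D.drift P c i = D.mass P c i • (D.centroid P c i - P i) := by
  have h1 : D.drift P c i = D.moment P c i - D.mass P c i • P i := by
    rw [drift, moment_eq, mass_eq, ← integral_smul_const, ← integral_sub]
    · simp_rw [smul_sub]
    · exact (hD.integrable_modDensity_smul c _ continuous_id).integrableOn
    · exact (hD.integrable_modDensity_smul c _ continuous_const).integrableOn
  rw [h1, smul_sub, centroid, smul_smul, mul_inv_cancel₀ h, one_smul]

/-- Testing the weighted average against an affine function turns each geometric claim about the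
centroid into the sign or size of an integral. -/
theorem mass_mul_sub_centroid {P : Fin N → Plane} {c : Fin m → ℝ} {i : Fin N}
    (h : D.mass P c i ≠ 0) (ℓ : Plane →L[ℝ] ℝ) (M : ℝ) :
    D.mass P c i * (M - ℓ (D.centroid P c i)) =
      ∫ q in nearestRegion P i, D.modDensity c (P i) q • (M - ℓ q) ∂D.area := by
  have h1 : ℓ (D.moment P c i) =
      ∫ q in nearestRegion P i, D.modDensity c (P i) q • ℓ q ∂D.area := by
    rw [moment_eq, ← ContinuousLinearMap.integral_comp_comm]
    · simp
    · exact (hD.integrable_modDensity_smul c _ continuous_id).integrableOn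
  simp_rw [smul_sub]
  rw [integral_sub, ← h1, integral_smul_const, ← mass_eq, centroid, map_smul, smul_eq_mul,
    smul_eq_mul, mul_sub, mul_inv_cancel_left₀ h]
  · exact (hD.integrable_modDensity_smul c _ continuous_const).integrableOn
  · exact (hD.integrable_modDensity_smul c _ ℓ.continuous).integrableOn

/-- A functional separating the centroid from the open interior would have a strictly positive
weighted integral, whereas the identity above makes that integral zero. -/
theorem centroid_mem_interior {P : Fin N → Plane} {i : Fin N}
    (hA : 0 < D.area (nearestRegion P i)) {c : Fin m → ℝ} (hc : ∀ j, D.amin ≤ c j) :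
    D.centroid P c i ∈ interior D.Q := by
  by_contra hcon
  obtain ⟨ℓ, hℓ⟩ := geometric_hahn_banach_open_point hD.convex.interior isOpen_interior hcon
  have hm := hD.mass_pos hA hc
  have h1 := hD.mass_mul_sub_centroid hm.ne' ℓ (ℓ (D.centroid P c i))
  have h2 := cellIntegral_pos hA
    (hD.integrable_modDensity_smul c (P i) (f := fun q => ℓ (D.centroid P c i) - ℓ q)
      (by fun_prop)) (by
    filter_upwards [hD.ae_modDensity_pos hc (P i), hD.ae_mem_interior] with q hq hq'
    exact mul_pos hq (sub_pos.2 (hℓ q hq')))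
  rw [← h1] at h2
  simp at h2

theorem clm_centroid_le {P : Fin N → Plane} {i : Fin N}
    (hA : 0 < D.area (nearestRegion P i)) {c : Fin m → ℝ} (hc : ∀ j, D.amin ≤ c j)
    (ℓ : Plane →L[ℝ] ℝ) (M : ℝ) (hℓ : ∀ q ∈ nearestRegion P i, ℓ q ≤ M) :
    ℓ (D.centroid P c i) ≤ M := by
  have hm := hD.mass_pos hA hc
  have h1 := hD.mass_mul_sub_centroid hm.ne' ℓ M
  have h2 : 0 ≤ ∫ q in nearestRegion P i, D.modDensity c (P i) q • (M - ℓ q) ∂D.area := by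
    refine integral_nonneg_of_ae ?_
    filter_upwards [ae_restrict_of_ae hD.ae_mem,
      ae_restrict_mem (measurableSet_nearestRegion P i)] with q hq hq'
    exact mul_nonneg (hD.modDensity_nonneg hc _ hq) (sub_nonneg.2 (hℓ q hq'))
  rw [← h1] at h2
  have := nonneg_of_mul_nonneg_right h2 hm
  linarith

theorem sq_norm_le_inner_centroid {P : Fin N → Plane} {i j : Fin N} (hij : j ≠ i)
    (hA : 0 < D.area (nearestRegion P i)) {c : Fin m → ℝ} (hc : ∀ j, D.amin ≤ c j) :
    ‖P i - P j‖ ^ 2 ≤ 2 * inner ℝ (P i - P j) (D.centroid P c i - P j) := by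
  have := hD.clm_centroid_le hA hc (-(innerSL ℝ (P i - P j)))
    (-(‖P i - P j‖ ^ 2 / 2 + inner ℝ (P i - P j) (P j))) (fun q hq => by
      have := inner_midpoint_nonneg hij hq
      rw [inner_sub_right] at this
      simp only [neg_apply, innerSL_apply_apply]
      linarith)
  simp only [neg_apply, innerSL_apply_apply] at this
  rw [inner_sub_right]
  linarith

/-- Each centroid lies on its own side of the bisector; adding the two half-plane inequalities
cancels the terms in ‖P i - P j‖². The two robots may use different estimates. -/
theorem inner_centroid_sub_nonneg {P : Fin N → Plane} {i j : Fin N} (hij : j ≠ i)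
    (hA : ∀ i, 0 < D.area (nearestRegion P i)) {c c' : Fin m → ℝ} (hc : ∀ j, D.amin ≤ c j)
    (hc' : ∀ j, D.amin ≤ c' j) :
    0 ≤ inner ℝ (P i - P j) (D.centroid P c i - D.centroid P c' j) := by
  have h1 := hD.sq_norm_le_inner_centroid hij (hA i) hc
  have h2 := hD.sq_norm_le_inner_centroid hij.symm (hA j) hc'
  have h3 : D.centroid P c i - D.centroid P c' j =
      (D.centroid P c i - P j) - (D.centroid P c' j - P i) - (P i - P j) := by abel
  rw [h3, inner_sub_right, inner_sub_right, real_inner_self_eq_norm_sq]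
  rw [norm_sub_rev, ← neg_sub (P i) (P j), inner_neg_left] at h2
  linarith

end Regular

theorem steeringMatrix_mul_inv {d : ℝ} (hd : 0 < d) (θ : ℝ) :
    steeringMatrix d θ * (steeringMatrix d θ)⁻¹ = 1 := by
  refine Matrix.mul_nonsing_inv _ ?_
  have : (steeringMatrix d θ).det = d := by
    rw [steeringMatrix, Matrix.det_fin_two_of]
    linear_combination d * Real.sin_sq_add_cos_sq θ
  rw [this]
  exact hd.ne'.isUnit

theorem velocity_control (hd : 0 < D.d) (P : Fin N → Plane) (θ : ℝ) (c : Fin m → ℝ) (i : Fin N) :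
    D.velocity θ (D.control P θ c i) = -D.k₁ • (P i - D.centroid P c i) := by
  rw [velocity, control, WithLp.ofLp_toLp, Matrix.mulVec_smul, Matrix.mulVec_mulVec,
    steeringMatrix_mul_inv hd, Matrix.one_mulVec]
  rfl

theorem adaptRate_apply (c b : Fin m → ℝ) (j : Fin m) :
    D.adaptRate c b j = D.g j * (b j - projectionMatrix D.amin c b j j * b j) := by
  simp [adaptRate, projectionMatrix, Matrix.mulVec_diagonal]

/-- A closed-loop trajectory together with the standing assumptions of the convergence theorem. -/
structure ClosedLoop (D : Controller m) (a : Fin m → ℝ) (p : Fin N → ℝ → Plane)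
    (θ : Fin N → ℝ → ℝ) (v : Fin N → ℝ → EuclideanSpace ℝ (Fin 2))
    (L : Fin N → ℝ → Matrix (Fin m) (Fin m) ℝ) (l c : Fin N → ℝ → Fin m → ℝ) : Prop where
  regular : D.Regular
  traj : D.IsTrajectory a p θ v L l c
  amin_lt : ∀ j, D.amin < a j
  d_pos : 0 < D.d
  k₁_pos : 0 < D.k₁
  k₂_pos : 0 < D.k₂
  k₃_pos : 0 < D.k₃
  α_pos : 0 < D.α
  g_pos : ∀ j, 0 < D.g j
  init_mem : ∀ i, p i 0 ∈ D.Q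
  init_inj : Function.Injective fun i => p i 0
  init_estimate : ∀ i j, D.amin ≤ c i 0 j

/-! ### Invariance of the region and absence of finite-time collisions -/

namespace ClosedLoop

variable {a : Fin m → ℝ} {p : Fin N → ℝ → Plane} {θ : Fin N → ℝ → ℝ}
  {v : Fin N → ℝ → EuclideanSpace ℝ (Fin 2)} {L : Fin N → ℝ → Matrix (Fin m) (Fin m) ℝ}
  {l c : Fin N → ℝ → Fin m → ℝ} (h : D.ClosedLoop a p θ v L l c)
include h

theorem velocity_eq (i : Fin N) {t : ℝ} (ht : 0 ≤ t) :
    D.velocity (θ i t) (v i t) =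
      -D.k₁ • (p i t - D.centroid (fun k => p k t) (c i t) i) := by
  rw [h.traj.input i t ht, velocity_control h.d_pos]

theorem hasDerivWithinAt_position (i : Fin N) {t : ℝ} (ht : 0 ≤ t) :
    HasDerivWithinAt (p i) (-D.k₁ • (p i t - D.centroid (fun k => p k t) (c i t) i))
      (Ici 0) t := by
  rw [← h.velocity_eq i ht]
  exact h.traj.position i t ht

/-- Below the bound the projection annihilates the whole adaptation rate, so the estimate is
stationary there and can never cross. -/
theorem amin_le_estimate (i : Fin N) {t : ℝ} (ht : 0 ≤ t) (j : Fin m) : D.amin ≤ c i t j := by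
  refine le_of_stationary_below (h.traj.estimate_absCont i j) ?_ (h.init_estimate i j) ht
  filter_upwards [h.traj.estimate i j] with s hs hs0 hlt
  refine (hs hs0).congr_deriv ?_
  rw [adaptRate_apply]
  simp [projectionMatrix, hlt.ne, not_lt.2 hlt.le]

theorem continuousOn_position (i : Fin N) : ContinuousOn (p i) (Ici 0) := fun _ ht =>
  (h.hasDerivWithinAt_position i ht).continuousWithinAt

/-- For a functional f separating p_i(t) from the closed region at level u, the gap y = u − f(p_i)
satisfies y' ≥ −k₁y because f is below u at the centroid; a positive gap therefore stays positive.
-/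
theorem position_mem_closure_of_area_pos {s t : ℝ} (hs : 0 ≤ s) (hst : s ≤ t) (i : Fin N)
    (hA : ∀ r ∈ Icc s t, 0 < D.area (nearestRegion (fun k => p k r) i))
    (hp : p i s ∈ closure D.Q) : p i t ∈ closure D.Q := by
  by_contra hcon
  obtain ⟨f, u, hf, hu⟩ :=
    geometric_hahn_banach_closed_point h.regular.convex.closure isClosed_closure hcon
  have hm := monotoneOn_exp_mul (y := fun r => u - f (p i r)) (k := D.k₁) (b := t) hs
    (fun r hr => (f.hasFDerivAt.comp_hasDerivWithinAt r
      (h.hasDerivWithinAt_position i hr)).const_sub u) (fun r hr => by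
    have h1 := h.regular.centroid_mem_interior (hA r ⟨hr.1.le, hr.2.le⟩)
      (h.amin_le_estimate i (hs.trans hr.1.le))
    have h2 := hf _ (subset_closure (interior_subset h1))
    simp only [map_smul, map_sub, smul_eq_mul]
    nlinarith [h.k₁_pos])
  have h1 := hm (left_mem_Icc.2 hst) (right_mem_Icc.2 hst) hst
  have h2 := hf _ hp
  have h3 : 0 < Real.exp (D.k₁ * s) * (u - f (p i s)) :=
    mul_pos (Real.exp_pos _) (sub_pos.2 h2)
  have h4 : Real.exp (D.k₁ * t) * (u - f (p i t)) < 0 :=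
    mul_neg_of_pos_of_neg (Real.exp_pos _) (sub_neg.2 hu)
  simp only at h1
  linarith

/-- The squared distance has derivative 2k₁⟨p_i − p_j, C_i − C_j⟩ − 2k₁‖p_i − p_j‖², and the first
term is nonnegative. -/
theorem exp_mul_sq_dist_le_of_area_pos {s t : ℝ} (hs : 0 ≤ s) (hst : s ≤ t) {i j : Fin N}
    (hij : j ≠ i) (hA : ∀ r ∈ Icc s t, ∀ i, 0 < D.area (nearestRegion (fun k => p k r) i)) :
    Real.exp (2 * D.k₁ * s) * ‖p i s - p j s‖ ^ 2 ≤
      Real.exp (2 * D.k₁ * t) * ‖p i t - p j t‖ ^ 2 := by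
  have hm := monotoneOn_exp_mul (y := fun r => ‖p i r - p j r‖ ^ 2) (k := 2 * D.k₁) (b := t) hs
    (fun r hr => ((h.hasDerivWithinAt_position i hr).sub
      (h.hasDerivWithinAt_position j hr)).norm_sq) (fun r hr => by
    have hr0 := hs.trans hr.1.le
    have h1 := h.regular.inner_centroid_sub_nonneg hij (hA r ⟨hr.1.le, hr.2.le⟩)
      (h.amin_le_estimate i hr0) (h.amin_le_estimate j hr0)
    have h2 : -D.k₁ • (p i r - D.centroid (fun k => p k r) (c i r) i) -
        -D.k₁ • (p j r - D.centroid (fun k => p k r) (c j r) j) =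
        D.k₁ • (D.centroid (fun k => p k r) (c i r) i - D.centroid (fun k => p k r) (c j r) j) -
        D.k₁ • (p i r - p j r) := by module
    simp only [Pi.sub_apply]
    rw [h2, inner_sub_right, inner_smul_right, inner_smul_right, real_inner_self_eq_norm_sq]
    nlinarith [mul_nonneg h.k₁_pos.le h1])
  exact hm (left_mem_Icc.2 hst) (right_mem_Icc.2 hst) hst

/-- Continuous induction. The two invariants depend on positive cell areas, and these areas stay
positive for a short time after any configuration where the invariants hold. -/
theorem mem_closure_and_injective {t : ℝ} (ht : 0 ≤ t) :
    (∀ i, p i t ∈ closure D.Q) ∧ Function.Injective fun i => p i t := by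
  let P : ℝ → Fin N → Plane := fun s i => p i (max 0 s)
  have hPc : Continuous P := continuous_pi fun i =>
    (h.continuousOn_position i).comp_continuous (by fun_prop) fun s => mem_Ici.2 (le_max_left _ _)
  have hP : ∀ s, 0 ≤ s → P s = fun i => p i s := fun s hs => by simp [P, hs]
  -- Injectivity is not a closed condition; the exponential lower bound on distances is closed and
  -- implies it.
  let S : Set ℝ := {s | (∀ i, P s i ∈ closure D.Q) ∧ ∀ i j, j ≠ i →
    ‖P 0 i - P 0 j‖ ^ 2 ≤ Real.exp (2 * D.k₁ * s) * ‖P s i - P s j‖ ^ 2}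
  have hinj : ∀ s ∈ S, Function.Injective (P s) := by
    intro s hs i j hij
    by_contra hne
    have h1 := hs.2 i j (Ne.symm hne)
    rw [hij] at h1
    simp only [sub_self, norm_zero, ne_eq, OfNat.ofNat_ne_zero, not_false_eq_true, zero_pow,
      mul_zero] at h1
    have h2 : ‖P 0 i - P 0 j‖ = 0 := by
      have := sq_nonneg ‖P 0 i - P 0 j‖
      exact pow_eq_zero_iff two_ne_zero |>.1 (le_antisymm h1 this)
    rw [hP 0 le_rfl, norm_sub_eq_zero_iff] at h2
    exact hne (h.init_inj h2)
  have hSc : IsClosed S := by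
    refine IsClosed.and ?_ ?_
    · simp only [ofPred_forall]
      exact isClosed_iInter fun i =>
        isClosed_closure.preimage ((continuous_apply i).comp hPc)
    · simp only [ofPred_forall]
      refine isClosed_iInter fun i => isClosed_iInter fun j => isClosed_iInter fun _ =>
        isClosed_le continuous_const ?_
      have h1 : Continuous fun s => P s i := (continuous_apply i).comp hPc
      have h2 : Continuous fun s => P s j := (continuous_apply j).comp hPc
      fun_prop
  have hS : t ∈ S := by
    refine (IsClosed.Icc_subset_of_forall_exists_gt (a := 0) (b := t)
      (hSc.inter isClosed_Icc) ⟨fun i => ?_, fun i j _ => by simp⟩ ?_) (right_mem_Icc.2 ht)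
    · rw [hP 0 le_rfl]
      exact subset_closure (h.init_mem i)
    · rintro s ⟨hsS, hs0, -⟩ y hy
      have hev := hPc.continuousAt.eventually
        (h.regular.eventually_area_pos hsS.1 (hinj s hsS))
      obtain ⟨η, hη, hball⟩ := Metric.eventually_nhds_iff.1 hev
      have hr : s < min y (s + η / 2) := lt_min hy (by linarith)
      have hA : ∀ r ∈ Icc s (min y (s + η / 2)), ∀ i,
          0 < D.area (nearestRegion (fun k => p k r) i) := by
        intro r hr i
        have h1 : r ≤ s + η / 2 := hr.2.trans (min_le_right _ _)
        have := hball (y := r) (by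
          rw [Real.dist_eq, abs_of_nonneg (sub_nonneg.2 hr.1)]; linarith) i
        rwa [hP r (hs0.trans hr.1)] at this
      refine ⟨min y (s + η / 2), ⟨fun i => ?_, fun i j hij => ?_⟩, hr, min_le_left _ _⟩
      · rw [hP _ (hs0.trans hr.le)]
        refine h.position_mem_closure_of_area_pos hs0 hr.le i (fun r hr => hA r hr i) ?_
        have := hsS.1 i
        rwa [hP s hs0] at this
      · refine (hsS.2 i j hij).trans ?_
        rw [hP _ (hs0.trans hr.le), hP s hs0]
        exact h.exp_mul_sq_dist_le_of_area_pos hs0 hr.le hij hA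
  have h1 := hinj t hS
  have h2 := hS.1
  rw [hP t ht] at h1 h2
  exact ⟨h2, h1⟩

theorem area_pos {t : ℝ} (ht : 0 ≤ t) (i : Fin N) :
    0 < D.area (nearestRegion (fun k => p k t) i) :=
  h.regular.area_pos (h.mem_closure_and_injective ht).1 (h.mem_closure_and_injective ht).2 i

theorem mass_pos {t : ℝ} (ht : 0 ≤ t) (i : Fin N) :
    0 < D.mass (fun k => p k t) (c i t) i :=
  h.regular.mass_pos (h.area_pos ht i) (h.amin_le_estimate i ht)

theorem centroid_mem_interior {t : ℝ} (ht : 0 ≤ t) (i : Fin N) :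
    D.centroid (fun k => p k t) (c i t) i ∈ interior D.Q :=
  h.regular.centroid_mem_interior (h.area_pos ht i) (h.amin_le_estimate i ht)

/-- Closure membership is not enough, since the basis functions are controlled only on the region
itself. At a positive time even the interior is reached: otherwise, for a supporting functional f,
the gap u − f(p_i) is nonnegative, vanishes at t, and by the monotone weighted gap vanishes on all
of [0, t]; yet attraction to an interior centroid gives it a nonzero derivative at t/2. -/
theorem position_mem {t : ℝ} (ht : 0 ≤ t) (i : Fin N) : p i t ∈ D.Q := by
  rcases ht.eq_or_lt with rfl | ht0
  · exact h.init_mem i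
  refine interior_subset (s := D.Q) ?_
  by_contra hcon
  obtain ⟨f, hf⟩ := geometric_hahn_banach_open_point h.regular.convex.interior isOpen_interior hcon
  set u := f (p i t)
  have hle : ∀ r, 0 ≤ r → f (p i r) ≤ u := by
    intro r hr
    have h1 := (h.mem_closure_and_injective hr).1 i
    rw [← h.regular.convex.closure_interior_eq_closure_of_nonempty_interior
      h.regular.interior_nonempty] at h1
    exact closure_minimal (t := {q | f q ≤ u}) (fun q hq => (hf q hq).le)
      (isClosed_le f.continuous continuous_const) h1
  have hder : ∀ r, 0 ≤ r → HasDerivWithinAt (fun r => u - f (p i r))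
      (-(f (-D.k₁ • (p i r - D.centroid (fun k => p k r) (c i r) i)))) (Ici 0) r :=
    fun r hr => (f.hasFDerivAt.comp_hasDerivWithinAt r
      (h.hasDerivWithinAt_position i hr)).const_sub u
  have hm := monotoneOn_exp_mul (k := D.k₁) (b := t) le_rfl hder (fun r hr => by
    have h2 := hf _ (h.centroid_mem_interior hr.1.le i)
    simp only [map_smul, map_sub, smul_eq_mul]
    nlinarith [h.k₁_pos])
  have hz : ∀ r ∈ Icc 0 t, u - f (p i r) = 0 := by
    intro r hr
    have h1 := hm hr (right_mem_Icc.2 ht) hr.2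
    simp only [u, sub_self, mul_zero] at h1
    have h2 := nonpos_of_mul_nonpos_right h1 (Real.exp_pos _)
    exact le_antisymm h2 (sub_nonneg.2 (hle r hr.1))
  have hd := hasDerivAt_of_within_Ici (hder (t / 2) (by positivity)) (by positivity)
  have hd0 : HasDerivAt (fun r => u - f (p i r)) 0 (t / 2) := by
    refine (hasDerivAt_const (t / 2) (0 : ℝ)).congr_of_eventuallyEq ?_
    filter_upwards [Icc_mem_nhds (show 0 < t / 2 by positivity) (show t / 2 < t by linarith)]
      with r hr using hz r hr
  have heq := hd.unique hd0
  have h2 := hf _ (h.centroid_mem_interior (show 0 ≤ t / 2 by positivity) i)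
  have h3 := hz (t / 2) ⟨by positivity, by linarith⟩
  simp only [map_smul, map_sub, smul_eq_mul] at heq
  nlinarith [h.k₁_pos]

theorem exists_position_lipschitz : ∃ C, 0 < C ∧ (∀ i t, 0 ≤ t →
      ‖-D.k₁ • (p i t - D.centroid (fun k => p k t) (c i t) i)‖ ≤ C) ∧
    ∀ i s t, 0 ≤ s → 0 ≤ t → ‖p i t - p i s‖ ≤ C * |t - s| := by
  obtain ⟨R, hR, hb⟩ := h.regular.exists_norm_bound
  have hk := h.k₁_pos
  have hv : ∀ i t, 0 ≤ t →
      ‖-D.k₁ • (p i t - D.centroid (fun k => p k t) (c i t) i)‖ ≤ D.k₁ * (R + R) := by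
    intro i t ht
    rw [norm_smul, norm_neg, Real.norm_of_nonneg hk.le]
    gcongr
    exact (norm_sub_le _ _).trans (add_le_add (hb _ (subset_closure (h.position_mem ht i)))
      (hb _ (subset_closure (interior_subset (h.centroid_mem_interior ht i)))))
  refine ⟨D.k₁ * (R + R), by positivity, hv, fun i s t hs ht => ?_⟩
  exact (convex_Ici (0 : ℝ)).norm_image_sub_le_of_norm_hasDerivWithin_le
    (fun r hr => h.hasDerivWithinAt_position i hr) (fun r hr => hv i r hr) hs ht

end ClosedLoop

/-! ### The filters -/

namespace ClosedLoop

variable {a : Fin m → ℝ} {p : Fin N → ℝ → Plane} {θ : Fin N → ℝ → ℝ}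
  {v : Fin N → ℝ → EuclideanSpace ℝ (Fin 2)} {L : Fin N → ℝ → Matrix (Fin m) (Fin m) ℝ}
  {l c : Fin N → ℝ → Fin m → ℝ} (h : D.ClosedLoop a p θ v L l c)
include h

/-- The difference solves the homogeneous filter equation with zero initial value, so the filter
bound applies with B = 0. -/
theorem filterVector_eq (i : Fin N) {t : ℝ} (ht : 0 ≤ t) : l i t = L i t *ᵥ a := by
  funext j
  have h1 := abs_le_of_filter (y := fun t => l i t j - ∑ k, L i t j k * a k) (f := fun _ => 0)
    (B := 0) h.α_pos (by simp [h.traj.filterVector_zero, h.traj.filterMatrix_zero])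
    (fun s hs => by
      refine ((h.traj.filterVector i j s hs).sub (HasDerivWithinAt.fun_sum fun k _ =>
        (h.traj.filterMatrix i j k s hs).mul_const (a k))).congr_deriv ?_
      simp only [density, dotProduct, add_mul, Finset.sum_add_distrib, Finset.mul_sum, mul_sub,
        mul_assoc]
      ring) (by simp) ht
  rw [zero_div] at h1
  exact sub_eq_zero.1 (abs_nonpos_iff.1 h1)

theorem exists_filterMatrix_bound : ∃ B, 0 < B ∧
    ∀ i t j k, 0 ≤ t → |L i t j k| ≤ B := by
  obtain ⟨B, hB, hK⟩ := h.regular.exists_basis_bound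
  have := h.α_pos
  refine ⟨B * B / D.α, by positivity, fun i t j k ht => ?_⟩
  refine abs_le_of_filter (y := fun s => L i s j k) h.α_pos
    (by simp [h.traj.filterMatrix_zero]) (h.traj.filterMatrix i j k) (fun s hs => ?_) ht
  rw [abs_mul]
  have := hK _ (h.position_mem hs i)
  exact mul_le_mul (this j) (this k) (abs_nonneg _) hB.le

theorem hasDerivWithinAt_quadForm (i : Fin N) (x : Fin m → ℝ) {t : ℝ} (ht : 0 ≤ t) :
    HasDerivWithinAt (fun s => x ⬝ᵥ L i s *ᵥ x)
      (-D.α * (x ⬝ᵥ L i t *ᵥ x) + D.density x (p i t) ^ 2) (Ici 0) t := by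
  simp only [dotProduct, Matrix.mulVec, density]
  refine (HasDerivWithinAt.fun_sum fun j _ => (HasDerivWithinAt.fun_sum fun k _ =>
    (h.traj.filterMatrix i j k t ht).mul_const (x k)).const_mul (x j)).congr_deriv ?_
  rw [sq, Finset.sum_mul_sum]
  simp only [Finset.mul_sum]
  rw [← Finset.sum_add_distrib]
  refine Finset.sum_congr rfl fun j _ => ?_
  rw [← Finset.sum_add_distrib]
  exact Finset.sum_congr rfl fun k _ => by ring

/-- On [s, r] the form is driven by at least κ, starting from a nonnegative value; from r to t it
can at worst decay at rate α. The vector x is constant in time here. -/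
theorem quadForm_lower_bound (i : Fin N) (x : Fin m → ℝ) {s r t κ : ℝ} (hs : 0 ≤ s) (hsr : s ≤ r)
    (hrt : r ≤ t) (hf : ∀ u ∈ Ioo s r, κ ≤ D.density x (p i u) ^ 2) :
    Real.exp (-(D.α * (t - r))) * (κ / D.α * (1 - Real.exp (-(D.α * (r - s))))) ≤
      x ⬝ᵥ L i t *ᵥ x := by
  have hα := h.α_pos
  have hmono : ∀ {s t : ℝ}, 0 ≤ s → s ≤ t → Real.exp (D.α * s) * (x ⬝ᵥ L i s *ᵥ x) ≤
      Real.exp (D.α * t) * (x ⬝ᵥ L i t *ᵥ x) := by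
    intro s t hs hst
    exact monotoneOn_exp_mul (y := fun s => x ⬝ᵥ L i s *ᵥ x) (k := D.α) (b := t) hs
      (fun r hr => h.hasDerivWithinAt_quadForm i x hr) (fun r _ => by
        have := sq_nonneg (D.density x (p i r)); linarith)
      (left_mem_Icc.2 hst) (right_mem_Icc.2 hst) hst
  have hs0 : 0 ≤ x ⬝ᵥ L i s *ᵥ x := by
    have := hmono le_rfl hs
    simp only [h.traj.filterMatrix_zero, Matrix.zero_mulVec, dotProduct_zero, mul_zero] at this
    exact nonneg_of_mul_nonneg_right this (Real.exp_pos _)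
  have h1 := monotoneOn_exp_mul (y := fun s => x ⬝ᵥ L i s *ᵥ x - κ / D.α) (k := D.α) (b := r) hs
    (fun r hr => (h.hasDerivWithinAt_quadForm i x hr).sub_const _) (fun u hu => by
      have h1 := hf u hu
      have h2 : D.α * (κ / D.α) = κ := by field_simp
      linarith) (left_mem_Icc.2 hsr) (right_mem_Icc.2 hsr) hsr
  have h2 := hmono (hs.trans hsr) hrt
  simp only at h1
  have e1 : Real.exp (-(D.α * (t - r))) = Real.exp (D.α * r) / Real.exp (D.α * t) := by
    rw [← Real.exp_sub]; congr 1; ring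
  have e2 : Real.exp (-(D.α * (r - s))) = Real.exp (D.α * s) / Real.exp (D.α * r) := by
    rw [← Real.exp_sub]; congr 1; ring
  rw [e1, e2, div_mul_eq_mul_div, div_le_iff₀ (Real.exp_pos _), mul_comm (x ⬝ᵥ _)]
  refine le_trans ?_ h2
  have h3 : Real.exp (D.α * r) * (κ / D.α * (1 - Real.exp (D.α * s) / Real.exp (D.α * r))) =
      κ / D.α * (Real.exp (D.α * r) - Real.exp (D.α * s)) := by
    field_simp
  rw [h3]
  nlinarith [mul_nonneg (Real.exp_pos (D.α * s)).le hs0]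

theorem quadForm_nonneg (i : Fin N) (x : Fin m → ℝ) {t : ℝ} (ht : 0 ≤ t) :
    0 ≤ x ⬝ᵥ L i t *ᵥ x := by
  simpa using h.quadForm_lower_bound i x (κ := 0) ht le_rfl le_rfl (by simp)

end ClosedLoop

end Controller

theorem abs_sup'_sub_sup'_le {ι : Type*} {s : Finset ι} (hs : s.Nonempty) {f g : ι → ℝ} {C : ℝ}
    (h : ∀ i ∈ s, |f i - g i| ≤ C) : |s.sup' hs f - s.sup' hs g| ≤ C := by
  rw [abs_le]
  constructor
  · have : s.sup' hs g ≤ s.sup' hs f + C := Finset.sup'_le _ _ fun i hi => by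
      have := (abs_le.1 (h i hi)).1
      have := Finset.le_sup' f hi
      linarith
    linarith
  · have : s.sup' hs f ≤ s.sup' hs g + C := Finset.sup'_le _ _ fun i hi => by
      have := (abs_le.1 (h i hi)).2
      have := Finset.le_sup' g hi
      linarith
    linarith

namespace Controller

variable {m N : ℕ} {D : Controller m}

/-! ### The coverage cost and its gradient -/

section Potential

variable [Nonempty (Fin N)]

/-- The largest value of the sensing functions of the robots at `q`. -/
def sensingSup (D : Controller m) (P : Fin N → Plane) (q : Plane) : ℝ :=
  Finset.univ.sup' Finset.univ_nonempty fun j => D.sensing ‖P j - q‖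

/-- The integrand of the coverage cost, normalized to have gradient `2 λ_i(q) (p_i - q)`. -/
def costDensity (D : Controller m) (a : Fin m → ℝ) (P : Fin N → Plane) (q : Plane) : ℝ :=
  D.σ ^ 2 * (D.γ / 2 * D.sensingSup P q ^ 2 - D.density a q * D.sensingSup P q)

/-- The coverage cost. -/
def cost (D : Controller m) (a : Fin m → ℝ) (P : Fin N → Plane) : ℝ :=
  ∫ q, D.costDensity a P q ∂D.area

theorem continuous_sensingSup (P : Fin N → Plane) : Continuous (D.sensingSup P) := by
  unfold sensingSup
  exact Continuous.finset_sup'_apply _ fun j _ => continuous_sensing_left (P j)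

theorem abs_sensingSup_le_one (P : Fin N → Plane) (q : Plane) : |D.sensingSup P q| ≤ 1 := by
  have i : Fin N := Classical.arbitrary _
  rw [sensingSup, abs_of_nonneg ((sensing_pos _).le.trans (Finset.le_sup' (fun j => D.sensing ‖P j - q‖)
    (Finset.mem_univ i)))]
  exact Finset.sup'_le _ _ fun j _ => sensing_le_one _

namespace Regular

variable (hD : D.Regular)
include hD

theorem exists_sensing_lipschitz : ∃ C, 0 < C ∧ ∀ x ∈ closure D.Q, ∀ y ∈ closure D.Q,
    ∀ q ∈ D.Q, |D.sensing ‖x - q‖ - D.sensing ‖y - q‖| ≤ C * ‖x - y‖ := by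
  obtain ⟨R, hR, hb⟩ := hD.exists_norm_bound
  have hσ := hD.σ_pos
  refine ⟨4 * R / D.σ ^ 2, by positivity, fun x hx y hy q hq => ?_⟩
  have key : ∀ A B : ℝ, 0 ≤ A → Real.exp (-A) - Real.exp (-B) ≤ |B - A| := by
    intro A B hA
    have h1 : Real.exp (-B) = Real.exp (-A) * Real.exp (A - B) := by
      rw [← Real.exp_add]; congr 1; ring
    have h2 := Real.add_one_le_exp (A - B)
    have h3 : Real.exp (-A) ≤ 1 := Real.exp_le_one_iff.2 (by linarith)
    have h4 := Real.exp_pos (-A)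
    have h5 : Real.exp (-A) - Real.exp (-B) ≤ Real.exp (-A) * (B - A) := by
      rw [h1]; nlinarith
    refine h5.trans ?_
    calc Real.exp (-A) * (B - A) ≤ Real.exp (-A) * |B - A| := by gcongr; exact le_abs_self _
      _ ≤ 1 * |B - A| := by gcongr
      _ = _ := one_mul _
  have hA : ∀ x : Plane, 0 ≤ ‖x - q‖ ^ 2 / D.σ ^ 2 := fun x => by positivity
  have h1 : |D.sensing ‖x - q‖ - D.sensing ‖y - q‖| ≤
      |‖x - q‖ ^ 2 / D.σ ^ 2 - ‖y - q‖ ^ 2 / D.σ ^ 2| := by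
    rw [abs_le']
    refine ⟨(key _ _ (hA x)).trans_eq (abs_sub_comm _ _), ?_⟩
    rw [neg_sub]
    exact key _ _ (hA y)
  refine h1.trans ?_
  rw [← sub_div, abs_div, abs_of_pos (by positivity : 0 < D.σ ^ 2), div_mul_eq_mul_div]
  gcongr
  rw [sq_sub_sq, abs_mul]
  have h2 : |‖x - q‖ - ‖y - q‖| ≤ ‖x - y‖ := by
    simpa using abs_norm_sub_norm_le (x - q) (y - q)
  have h3 : |‖x - q‖ + ‖y - q‖| ≤ 4 * R := by
    rw [abs_of_nonneg (by positivity)]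
    have := norm_sub_le x q
    have := norm_sub_le y q
    linarith [hb x hx, hb y hy, hb q (subset_closure hq)]
  exact mul_le_mul h3 h2 (abs_nonneg _) (by positivity)

theorem exists_costDensity_lipschitz (a : Fin m → ℝ) : ∃ C, 0 < C ∧
    ∀ P P' : Fin N → Plane, (∀ i, P i ∈ closure D.Q) → (∀ i, P' i ∈ closure D.Q) →
      ∀ q ∈ D.Q, |D.costDensity a P q - D.costDensity a P' q| ≤ C * ‖P - P'‖ := by
  obtain ⟨C, hC, h⟩ := hD.exists_sensing_lipschitz
  obtain ⟨B, hB, hφ⟩ := hD.exists_density_bound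
  have hγ := hD.γ_pos
  have hσ := hD.σ_pos
  refine ⟨D.σ ^ 2 * ((D.γ + B * ‖a‖) * C), by positivity, fun P P' hP hP' q hq => ?_⟩
  have h1 : |D.sensingSup P q - D.sensingSup P' q| ≤ C * ‖P - P'‖ := by
    refine abs_sup'_sub_sup'_le _ fun i _ => (h _ (hP i) _ (hP' i) q hq).trans ?_
    gcongr
    exact norm_le_pi_norm (P - P') i
  have h2 : D.costDensity a P q - D.costDensity a P' q = D.σ ^ 2 *
      ((D.γ / 2 * (D.sensingSup P q + D.sensingSup P' q) - D.density a q) *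
        (D.sensingSup P q - D.sensingSup P' q)) := by
    unfold costDensity; ring
  rw [h2, abs_mul, abs_of_pos (by positivity : 0 < D.σ ^ 2), mul_assoc, abs_mul, mul_assoc]
  gcongr
  refine (abs_sub _ _).trans (add_le_add ?_ (hφ a q hq))
  rw [abs_mul, abs_of_pos (by positivity)]
  have h3 := abs_add_le (D.sensingSup P q) (D.sensingSup P' q)
  have h4 := abs_sensingSup_le_one (D := D) P q
  have h5 := abs_sensingSup_le_one (D := D) P' q
  nlinarith

theorem continuousOn_costDensity (a : Fin m → ℝ) (P : Fin N → Plane) :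
    ContinuousOn (D.costDensity a P) D.Q := by
  unfold costDensity
  have h1 := (continuous_sensingSup (D := D) P).continuousOn (s := D.Q)
  have h2 := hD.continuousOn_density a
  fun_prop

theorem exists_costDensity_bound (a : Fin m → ℝ) : ∃ B, 0 < B ∧
    ∀ (P : Fin N → Plane), ∀ q ∈ D.Q, |D.costDensity a P q| ≤ B := by
  obtain ⟨B, hB, hφ⟩ := hD.exists_density_bound
  have hγ := hD.γ_pos
  have hσ := hD.σ_pos
  refine ⟨D.σ ^ 2 * (D.γ / 2 + B * ‖a‖), by positivity, fun P q hq => ?_⟩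
  have h4 := abs_sensingSup_le_one (D := D) P q
  rw [costDensity, abs_mul, abs_of_pos (by positivity : 0 < D.σ ^ 2)]
  gcongr
  refine (abs_sub _ _).trans (add_le_add ?_ ?_)
  · rw [abs_mul, abs_of_pos (by positivity), abs_pow]
    exact mul_le_of_le_one_right (by positivity) (pow_le_one₀ (abs_nonneg _) h4)
  · rw [abs_mul]
    exact (mul_le_of_le_one_right (abs_nonneg _) h4).trans (hφ a q hq)

theorem integrable_costDensity (a : Fin m → ℝ) (P : Fin N → Plane) :
    Integrable (D.costDensity a P) D.area := by
  obtain ⟨B, -, hB⟩ := hD.exists_costDensity_bound (N := N) a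
  exact hD.integrable (hD.continuousOn_costDensity a P) (hB P)

theorem exists_abs_cost_le (a : Fin m → ℝ) : ∃ B, ∀ P : Fin N → Plane, |D.cost a P| ≤ B := by
  have := hD.isFiniteMeasure
  obtain ⟨B, -, hB⟩ := hD.exists_costDensity_bound (N := N) a
  refine ⟨B * D.area.real univ, fun P => norm_integral_le_of_norm_le_const (μ := D.area) (f := D.costDensity a P) ?_⟩
  filter_upwards [hD.ae_mem] with q hq using hB P q hq

theorem exists_cost_lipschitz (a : Fin m → ℝ) : ∃ C, 0 ≤ C ∧
    ∀ P P' : Fin N → Plane, (∀ i, P i ∈ closure D.Q) → (∀ i, P' i ∈ closure D.Q) →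
      |D.cost a P - D.cost a P'| ≤ C * ‖P - P'‖ := by
  have := hD.isFiniteMeasure
  obtain ⟨C, hC, h⟩ := hD.exists_costDensity_lipschitz (N := N) a
  refine ⟨C * D.area.real univ, by positivity, fun P P' hP hP' => ?_⟩
  rw [cost, cost, ← integral_sub (hD.integrable_costDensity a P) (hD.integrable_costDensity a P')]
  refine (norm_integral_le_of_norm_le_const (μ := D.area) (C := C * ‖P - P'‖)
    (f := fun q => D.costDensity a P q - D.costDensity a P' q) ?_).trans_eq (by ring)
  filter_upwards [hD.ae_mem] with q hq using h P P' hP hP' q hq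

/-- The derivative of the coverage cost along a curve of pairwise distinct positions. -/
theorem hasDerivAt_cost (a : Fin m → ℝ) {P : ℝ → Fin N → Plane} {w : Fin N → Plane} {t C : ℝ}
    {s : Set ℝ} (hs : s ∈ 𝓝 t) (hmem : ∀ r ∈ s, ∀ i, P r i ∈ closure D.Q)
    (hC : 0 ≤ C) (hlip : ∀ r ∈ s, ∀ r' ∈ s, ‖P r - P r'‖ ≤ C * |r - r'|)
    (hP : ∀ i, HasDerivAt (fun r => P r i) (w i) t) (hinj : Function.Injective (P t)) :
    HasDerivAt (fun r => D.cost a (P r)) (-2 * ∑ i, inner ℝ (D.drift (P t) a i) (w i)) t := by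
  have := hD.isFiniteMeasure
  have hσ := hD.σ_pos
  obtain ⟨C', hC', hL⟩ := hD.exists_costDensity_lipschitz (N := N) a
  let G : Fin N → Plane → ℝ := fun i q =>
    -2 * inner ℝ (w i) (D.modDensity a (P t i) q • (q - P t i))
  have hGi : ∀ i, Integrable (G i) D.area := fun i =>
    ((hD.integrable_modDensity_smul a (P t i) (by fun_prop)).const_inner (w i)).const_mul (-2)
  let F' : Plane → ℝ := fun q => ∑ i, (nearestRegion (P t) i).indicator (G i) q
  have hF'i : Integrable F' D.area := integrable_finsetSum _ fun i _ =>
    (hGi i).indicator (measurableSet_nearestRegion _ _)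
  have hint : ∫ q, F' q ∂D.area = -2 * ∑ i, inner ℝ (D.drift (P t) a i) (w i) := by
    rw [integral_finsetSum _ fun i _ => (hGi i).indicator (measurableSet_nearestRegion _ _),
      Finset.mul_sum]
    refine Finset.sum_congr rfl fun i _ => ?_
    rw [integral_indicator (measurableSet_nearestRegion _ _), integral_const_mul,
      real_inner_comm, drift, ← integral_inner]
    exact (hD.integrable_modDensity_smul a (P t i) (by fun_prop)).integrableOn
  rw [← hint]
  refine (hasDerivAt_integral_of_dominated_loc_of_lip (bound := fun _ => C' * C) hs
    (Eventually.of_forall fun r => (hD.integrable_costDensity a (P r)).aestronglyMeasurable)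
    (hD.integrable_costDensity a (P t)) hF'i.aestronglyMeasurable ?_ (integrable_const _) ?_).2
  · filter_upwards [hD.ae_mem] with q hq
    refine LipschitzOnWith.of_dist_le_mul fun r hr r' hr' => ?_
    rw [Real.dist_eq, Real.dist_eq, Real.coe_nnabs, abs_of_nonneg (show 0 ≤ C' * C by positivity), mul_assoc]
    refine (hL _ _ (hmem r hr) (hmem r' hr') q hq).trans ?_
    gcongr
    exact hlip r hr r' hr'
  · filter_upwards [ae_norm_sub_ne hinj D.Q] with q hne
    obtain ⟨i, hi⟩ := exists_mem_nearestRegion (P t) (Classical.arbitrary _) q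
    have hF' : F' q = G i q := by
      simp only [F']
      rw [Finset.sum_eq_single i, indicator_of_mem hi]
      · intro j _ hji
        refine indicator_of_notMem (fun hj => ?_) _
        exact hne i j hji.symm (le_antisymm (hi j hji) (hj i hji.symm))
      · simp
    have hPc : ContinuousAt P t := continuousAt_pi.2 fun i => (hP i).continuousAt
    -- Off the bisectors one robot attains the supremum for all nearby times, so the cost integrand
    -- is differentiated as a single smooth Gaussian and no boundary terms appear.
    have hloc : (fun r => D.sensingSup (P r) q) =ᶠ[𝓝 t] fun r => D.sensing ‖P r i - q‖ := by
      filter_upwards [eventually_mem_nearestRegion_iff hPc hne i] with r hr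
      have hr := hr.2 hi
      refine le_antisymm (Finset.sup'_le _ _ fun j _ => ?_)
        (Finset.le_sup' (fun j => D.sensing ‖P r j - q‖) (Finset.mem_univ i))
      by_cases hji : j = i
      · rw [hji]
      · have := hr j hji
        rw [norm_sub_rev, norm_sub_rev q] at this
        unfold sensing
        gcongr
    have hsens : HasDerivAt (fun r => D.sensing ‖P r i - q‖)
        (D.sensing ‖P t i - q‖ * -(2 * inner ℝ (P t i - q) (w i) / D.σ ^ 2)) t :=
      (((hP i).sub_const q).norm_sq.div_const _).neg.exp
    have hS := hsens.congr_of_eventuallyEq hloc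
    have hSt : D.sensingSup (P t) q = D.sensing ‖P t i - q‖ := hloc.self_of_nhds
    refine ((((hS.pow 2).const_mul (D.γ / 2)).sub (hS.const_mul (D.density a q))).const_mul
      (D.σ ^ 2)).congr_deriv ?_
    rw [hF', hSt]
    simp only [G, modDensity]
    rw [inner_smul_right, ← neg_sub (P t i) q, inner_neg_right, real_inner_comm]
    field_simp
    ring

end Regular

end Potential

end Controller

theorem absCont_const (r s t : ℝ) : AbsolutelyContinuousOnInterval (fun _ => r) s t :=
  (LipschitzWith.const r).lipschitzOnWith.absolutelyContinuousOnInterval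

theorem absCont_sum {ι : Type*} (S : Finset ι) {f : ι → ℝ → ℝ} {s t : ℝ}
    (hf : ∀ i ∈ S, AbsolutelyContinuousOnInterval (f i) s t) :
    AbsolutelyContinuousOnInterval (fun x => ∑ i ∈ S, f i x) s t := by
  classical
  induction S using Finset.induction_on with
  | empty => simpa using absCont_const 0 s t
  | insert i S hi ih =>
    simp_rw [Finset.sum_insert hi]
    exact (hf i (Finset.mem_insert_self i S)).add
      (ih fun j hj => hf j (Finset.mem_insert_of_mem hj))

/-! ### The Lyapunov function -/

namespace Controller

variable {m N : ℕ} {D : Controller m}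

/-- The modified density is affine in the parameter and the γ-term cancels in the difference. What
remains is the coupling term that the adaptation law is designed to offset. -/
theorem Regular.inner_drift_sub_drift (hD : D.Regular) (P : Fin N → Plane) (c a : Fin m → ℝ)
    (i : Fin N) (w : Plane) : inner ℝ (D.drift P c i - D.drift P a i) w =
      (c - a) ⬝ᵥ (D.couplingMatrix P i *ᵥ WithLp.ofLp w) := by
  obtain ⟨B, hB, hK⟩ := hD.exists_basis_bound
  obtain ⟨R, hR, hb⟩ := hD.exists_norm_bound
  have h1 : D.drift P c i - D.drift P a i =
      ∫ q in nearestRegion P i, (D.modDensity c (P i) q • (q - P i) -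
        D.modDensity a (P i) q • (q - P i)) ∂D.area := by
    rw [drift, drift, integral_sub]
    · exact (hD.integrable_modDensity_smul c _ (by fun_prop)).integrableOn
    · exact (hD.integrable_modDensity_smul a _ (by fun_prop)).integrableOn
  have hint : ∀ (j : Fin m) (l : Fin 2),
      Integrable (fun q => D.sensing ‖P i - q‖ * D.K q j * (q l - P i l)) D.area := by
    intro j l
    refine hD.integrable (C := 1 * B * (R + ‖P i‖)) ?_ fun q hq => ?_
    · have h1 := hD.continuousOn_basis j
      have h2 := (continuous_sensing_left (D := D) (P i)).continuousOn (s := D.Q)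
      fun_prop
    · rw [norm_mul, norm_mul, Real.norm_of_nonneg (sensing_pos _).le]
      have h3 : ‖q l - P i l‖ ≤ R + ‖P i‖ := by
        have := PiLp.norm_apply_le (q - P i) l
        exact this.trans ((norm_sub_le _ _).trans
          (add_le_add_left (hb q (subset_closure hq)) _))
      have h4 := hK q hq j
      have h5 := sensing_le_one (D := D) ‖P i - q‖
      rw [← Real.norm_eq_abs] at h4
      gcongr
  rw [real_inner_comm, h1, ← integral_inner]
  · simp only [dotProduct, Matrix.mulVec, couplingMatrix_eq]
    simp_rw [Finset.mul_sum, ← integral_mul_const, ← integral_const_mul]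
    rw [Finset.sum_congr rfl fun j _ => (integral_finsetSum _ fun l _ =>
      (((hint j l).mul_const (w l)).const_mul ((c - a) j)).integrableOn).symm,
      ← integral_finsetSum _ fun j _ => integrable_finsetSum _ fun l _ =>
      (((hint j l).mul_const (w l)).const_mul ((c - a) j)).integrableOn]
    congr 1
    funext q
    rw [← sub_smul, inner_smul_right]
    have h2 : D.modDensity c (P i) q - D.modDensity a (P i) q =
        D.sensing ‖P i - q‖ * D.density (c - a) q := by
      rw [density_sub]; unfold modDensity; ring
    rw [h2, density, dotProduct, Finset.mul_sum, Finset.sum_mul]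
    refine Finset.sum_congr rfl fun j _ => ?_
    simp [PiLp.inner_apply, Fin.sum_univ_two]
    ring
  · exact ((hD.integrable_modDensity_smul c _ (by fun_prop)).sub
      (hD.integrable_modDensity_smul a _ (by fun_prop))).integrableOn

namespace ClosedLoop

/-- The Lyapunov function of the closed loop. -/
def lyapunov [Nonempty (Fin N)] (D : Controller m) (a : Fin m → ℝ) (p : Fin N → ℝ → Plane)
    (c : Fin N → ℝ → Fin m → ℝ) (t : ℝ) : ℝ :=
  D.k₂ / 2 * D.cost a (fun k => p k t) + ∑ i, ∑ j, (2 * D.g j)⁻¹ * (c i t j - a j) ^ 2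

/-- The guaranteed rate of decrease of the Lyapunov function. -/
def dissipation (D : Controller m) (a : Fin m → ℝ) (p : Fin N → ℝ → Plane)
    (L : Fin N → ℝ → Matrix (Fin m) (Fin m) ℝ) (c : Fin N → ℝ → Fin m → ℝ) (i : Fin N)
    (t : ℝ) : ℝ :=
  D.k₁ * D.k₂ * (D.mass (fun k => p k t) (c i t) i *
    ‖p i t - D.centroid (fun k => p k t) (c i t) i‖ ^ 2) +
  D.k₃ * ((c i t - a) ⬝ᵥ L i t *ᵥ (c i t - a))

variable {a : Fin m → ℝ} {p : Fin N → ℝ → Plane} {θ : Fin N → ℝ → ℝ}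
  {v : Fin N → ℝ → EuclideanSpace ℝ (Fin 2)} {L : Fin N → ℝ → Matrix (Fin m) (Fin m) ℝ}
  {l c : Fin N → ℝ → Fin m → ℝ} (h : D.ClosedLoop a p θ v L l c)
include h

theorem dissipation_nonneg (i : Fin N) {t : ℝ} (ht : 0 ≤ t) :
    0 ≤ dissipation D a p L c i t := by
  have h1 := h.quadForm_nonneg i (c i t - a) ht
  have h2 := h.mass_pos ht i
  have := h.k₁_pos
  have := h.k₂_pos
  have := h.k₃_pos
  unfold dissipation
  positivity

theorem exists_config_lipschitz : ∃ C, 0 < C ∧ ∀ s t, 0 ≤ s → 0 ≤ t →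
    ‖(fun k => p k t) - (fun k => p k s)‖ ≤ C * |t - s| := by
  obtain ⟨C, hC, -, hL⟩ := h.exists_position_lipschitz
  refine ⟨C, hC, fun s t hs ht => ?_⟩
  rw [pi_norm_le_iff_of_nonneg (by positivity)]
  exact fun i => hL i s t hs ht

theorem estimate_absCont (i : Fin N) (j : Fin m) {s t : ℝ} (hs : 0 ≤ s) (hst : s ≤ t) :
    AbsolutelyContinuousOnInterval (fun s => c i s j) s t :=
  (h.traj.estimate_absCont i j t (hs.trans hst)).mono (by
    rw [uIcc_of_le hst, uIcc_of_le (hs.trans hst)]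
    exact Icc_subset_Icc_left hs)

/-- The adaptation term never increases the Lyapunov function beyond the unprojected law. -/
theorem sum_adaptRate_le (i : Fin N) {t : ℝ} (ht : 0 ≤ t) (b : Fin m → ℝ) :
    ∑ j, (D.g j)⁻¹ * ((c i t j - a j) * D.adaptRate (c i t) b j) ≤ (c i t - a) ⬝ᵥ b := by
  refine Finset.sum_le_sum fun j _ => ?_
  have hg := h.g_pos j
  rw [adaptRate_apply]
  have h1 : (D.g j)⁻¹ * ((c i t j - a j) *
      (D.g j * (b j - projectionMatrix D.amin (c i t) b j j * b j))) =
      (c i t j - a j) * b j - (c i t j - a j) * (projectionMatrix D.amin (c i t) b j j * b j) := by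
    field_simp
  have h2 : 0 ≤ (c i t j - a j) * (projectionMatrix D.amin (c i t) b j j * b j) := by
    simp only [projectionMatrix, Matrix.diagonal_apply_eq]
    split_ifs with hif
    · simp
    · push Not at hif
      have h3 : c i t j = D.amin := le_antisymm hif.1 (h.amin_le_estimate i ht j)
      rw [one_mul]
      exact mul_nonneg_of_nonpos_of_nonpos (by linarith [h.amin_lt j]) (hif.2 h3).le
  rw [h1, Pi.sub_apply]
  linarith

/-- The coverage part of the adaptation replaces the drift of the true density by that of the
estimate, which is the mass times the displacement to the centroid, hence parallel to the velocity.
The estimate holds only almost everywhere, as the adaptation law does. -/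
theorem hasDerivAt_lyapunov_le [Nonempty (Fin N)] : ∀ᵐ t : ℝ, 0 < t →
    ∃ V', HasDerivAt (lyapunov D a p c) V' t ∧ V' ≤ -∑ i, dissipation D a p L c i t := by
  have hest : ∀ᵐ t : ℝ, ∀ i j, 0 ≤ t → HasDerivAt (fun s => c i s j)
      (D.adaptRate (c i t)
        (D.adaptDir (fun k => p k t) i (θ i t) (v i t) (c i t) (L i t) (l i t)) j) t :=
    ae_all_iff.2 fun i => ae_all_iff.2 fun j => h.traj.estimate i j
  obtain ⟨C, hC, hL⟩ := h.exists_config_lipschitz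
  filter_upwards [hest] with t ht ht0
  have hcl := h.mem_closure_and_injective ht0.le
  set w : Fin N → Plane := fun i => -D.k₁ • (p i t - D.centroid (fun k => p k t) (c i t) i)
  set b : Fin N → Fin m → ℝ := fun i =>
    D.adaptDir (fun k => p k t) i (θ i t) (v i t) (c i t) (L i t) (l i t) with hb
  have h1 := h.regular.hasDerivAt_cost a (P := fun r k => p k r) (w := w) (C := C) (t := t)
    (Ici_mem_nhds ht0) (fun r hr i => (h.mem_closure_and_injective hr).1 i) hC.le
    (fun r hr r' hr' => hL r' r hr' hr)
    (fun i => hasDerivAt_of_within_Ici (h.hasDerivWithinAt_position i ht0.le) ht0) hcl.2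
  have h2 : HasDerivAt (fun s => ∑ i, ∑ j, (2 * D.g j)⁻¹ * (c i s j - a j) ^ 2)
      (∑ i, ∑ j, (2 * D.g j)⁻¹ * (2 * (c i t j - a j) * D.adaptRate (c i t) (b i) j)) t :=
    HasDerivAt.fun_sum fun i _ => HasDerivAt.fun_sum fun j _ => by
      have := (((ht i j ht0.le).sub_const (a j)).fun_pow 2).const_mul ((2 * D.g j)⁻¹)
      simpa using this
  refine ⟨_, (h1.const_mul (D.k₂ / 2)).add h2, ?_⟩
  have h3 : D.k₂ / 2 * (-2 * ∑ i, inner ℝ (D.drift (fun k => p k t) a i) (w i)) =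
      ∑ i, -(D.k₂ * inner ℝ (D.drift (fun k => p k t) a i) (w i)) := by
    rw [Finset.sum_neg_distrib, ← Finset.mul_sum]; ring
  rw [h3, ← Finset.sum_add_distrib, ← Finset.sum_neg_distrib]
  refine Finset.sum_le_sum fun i _ => ?_
  have h4 : ∑ j, (2 * D.g j)⁻¹ * (2 * (c i t j - a j) * D.adaptRate (c i t) (b i) j) =
      ∑ j, (D.g j)⁻¹ * ((c i t j - a j) * D.adaptRate (c i t) (b i) j) :=
    Finset.sum_congr rfl fun j _ => by rw [mul_inv]; ring
  have h5 := h.sum_adaptRate_le i ht0.le (b i)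
  have h6 : (c i t - a) ⬝ᵥ b i =
      -D.k₂ * inner ℝ (D.drift (fun k => p k t) (c i t) i - D.drift (fun k => p k t) a i) (w i) -
      D.k₃ * ((c i t - a) ⬝ᵥ L i t *ᵥ (c i t - a)) := by
    rw [h.regular.inner_drift_sub_drift, hb]
    simp only [adaptDir]
    rw [h.velocity_eq i ht0.le, h.filterVector_eq i ht0.le, ← Matrix.mulVec_sub, dotProduct_sub,
      dotProduct_smul, dotProduct_smul, smul_eq_mul, smul_eq_mul]
  have h7 : inner ℝ (D.drift (fun k => p k t) (c i t) i) (w i) =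
      D.k₁ * (D.mass (fun k => p k t) (c i t) i *
        ‖p i t - D.centroid (fun k => p k t) (c i t) i‖ ^ 2) := by
    simp only [w]
    rw [h.regular.drift_eq (h.mass_pos ht0.le i).ne', inner_smul_left, inner_smul_right,
      ← neg_sub (p i t), inner_neg_left, real_inner_self_eq_norm_sq]
    simp only [conj_trivial]
    ring
  rw [h4, dissipation]
  rw [inner_sub_left, h7] at h6
  linarith

theorem absCont_lyapunov [Nonempty (Fin N)] {s t : ℝ} (hs : 0 ≤ s) (hst : s ≤ t) :
    AbsolutelyContinuousOnInterval (lyapunov D a p c) s t := by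
  refine AbsolutelyContinuousOnInterval.add (AbsolutelyContinuousOnInterval.const_mul _ ?_)
    (absCont_sum _ fun i _ => absCont_sum _ fun j _ =>
      AbsolutelyContinuousOnInterval.const_mul _ ?_)
  · obtain ⟨C, hC, hL⟩ := h.exists_config_lipschitz
    obtain ⟨C', hC', hL'⟩ := h.regular.exists_cost_lipschitz (N := N) a
    refine LipschitzOnWith.absolutelyContinuousOnInterval (K := Real.toNNReal (C' * C))
      (LipschitzOnWith.of_dist_le_mul fun r hr r' hr' => ?_)
    rw [uIcc_of_le hst] at hr hr'
    have hr0 := hs.trans hr.1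
    have hr0' := hs.trans hr'.1
    rw [Real.dist_eq, Real.dist_eq, Real.coe_toNNReal _ (by positivity), mul_assoc]
    refine (hL' _ _ (h.mem_closure_and_injective hr0).1
      (h.mem_closure_and_injective hr0').1).trans ?_
    gcongr
    exact hL r' r hr0' hr0
  · have h1 := (h.estimate_absCont i j hs hst).sub (absCont_const (a j) s t)
    have := h1.mul h1
    simpa [sq, Pi.mul_def] using this

theorem lyapunov_sub_le [Nonempty (Fin N)] {s t κ : ℝ} (hs : 0 ≤ s) (hst : s ≤ t)
    (hκ : ∀ r ∈ Ioo s t, κ ≤ ∑ i, dissipation D a p L c i r) :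
    lyapunov D a p c t - lyapunov D a p c s ≤ -κ * (t - s) := by
  refine absCont_sub_le hst (h.absCont_lyapunov hs hst) ?_
  filter_upwards [h.hasDerivAt_lyapunov_le] with r hr hrs
  obtain ⟨V', h1, h2⟩ := hr (hs.trans_lt hrs.1)
  rw [h1.deriv]
  linarith [hκ r hrs]

theorem antitoneOn_lyapunov [Nonempty (Fin N)] : AntitoneOn (lyapunov D a p c) (Ici 0) := by
  intro s hs t ht hst
  have := h.lyapunov_sub_le (κ := 0) hs hst fun r hr =>
    Finset.sum_nonneg fun i _ => h.dissipation_nonneg i (le_trans hs hr.1.le)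
  linarith

theorem sum_estimate_nonneg (t : ℝ) : 0 ≤ ∑ i, ∑ j, (2 * D.g j)⁻¹ * (c i t j - a j) ^ 2 :=
  Finset.sum_nonneg fun i _ => Finset.sum_nonneg fun j _ => by
    have := h.g_pos j
    positivity

theorem exists_le_lyapunov [Nonempty (Fin N)] : ∃ B, ∀ t, B ≤ lyapunov D a p c t := by
  obtain ⟨B, hB⟩ := h.regular.exists_abs_cost_le (N := N) a
  refine ⟨D.k₂ / 2 * -B, fun t => ?_⟩
  have h1 := (abs_le.1 (hB fun k => p k t)).1
  have h2 := h.sum_estimate_nonneg t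
  have h3 := h.k₂_pos
  have : D.k₂ / 2 * -B ≤ D.k₂ / 2 * D.cost a (fun k => p k t) := by gcongr
  unfold lyapunov
  linarith

/-- The dissipation cannot stay above a positive level on intervals of fixed length forever. -/
theorem exists_forall_exists_dissipation_lt [Nonempty (Fin N)] {η κ : ℝ} (hη : 0 < η)
    (hκ : 0 < κ) :
    ∃ t₀, 0 ≤ t₀ ∧ ∀ t, t₀ ≤ t → ∃ r ∈ Ioo t (t + η), ∀ i, dissipation D a p L c i r < κ := by
  obtain ⟨B, hB⟩ := h.exists_le_lyapunov
  obtain ⟨t₀, ht₀, hV⟩ := exists_forall_sub_lt h.antitoneOn_lyapunov (fun t _ => hB t) hη.le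
    (mul_pos hκ hη)
  refine ⟨t₀, ht₀, fun t ht => ?_⟩
  by_contra! hcon
  have h0 := ht₀.trans ht
  have h1 := h.lyapunov_sub_le (κ := κ) h0 (by linarith : t ≤ t + η) fun r hr => by
    obtain ⟨i, hi⟩ := hcon r hr
    exact hi.trans (Finset.single_le_sum
      (fun k _ => h.dissipation_nonneg k (h0.trans hr.1.le)) (Finset.mem_univ i))
  have h2 := hV t ht
  rw [add_sub_cancel_left] at h1
  linarith

/-- The Lyapunov function does not increase and the cost is bounded uniformly in the configuration,
so the squared errors are bounded. -/
theorem exists_estimate_bound : ∃ B, 0 < B ∧ ∀ i t j, 0 ≤ t → |c i t j - a j| ≤ B := by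
  rcases isEmpty_or_nonempty (Fin N) with hN | hN
  · exact ⟨1, one_pos, fun i => hN.elim i⟩
  obtain ⟨B, hB⟩ := h.regular.exists_abs_cost_le (N := N) a
  have hk := h.k₂_pos
  have key : ∀ j, ∃ B', 0 < B' ∧ ∀ i t, 0 ≤ t → |c i t j - a j| ≤ B' := by
    intro j
    have hg := h.g_pos j
    set X := 2 * D.g j * (lyapunov D a p c 0 + D.k₂ / 2 * B) with hX
    -- X bounds the squared error, and X ≤ (|X| + 1)² whether X is small or large.
    refine ⟨|X| + 1, by positivity, fun i t ht => ?_⟩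
    have h1 : lyapunov D a p c t ≤ lyapunov D a p c 0 :=
      h.antitoneOn_lyapunov (mem_Ici.2 le_rfl) ht ht
    have h2 := (abs_le.1 (hB fun k => p k t)).1
    have h3 : D.k₂ / 2 * -B ≤ D.k₂ / 2 * D.cost a (fun k => p k t) := by gcongr
    have h4 : (2 * D.g j)⁻¹ * (c i t j - a j) ^ 2 ≤
        ∑ i, ∑ j, (2 * D.g j)⁻¹ * (c i t j - a j) ^ 2 := by
      have hnn : ∀ i j, 0 ≤ (2 * D.g j)⁻¹ * (c i t j - a j) ^ 2 := fun i j => by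
        have := h.g_pos j
        positivity
      exact (Finset.single_le_sum (f := fun j => (2 * D.g j)⁻¹ * (c i t j - a j) ^ 2)
        (fun j _ => hnn i j) (Finset.mem_univ j)).trans
        (Finset.single_le_sum (f := fun i => ∑ j, (2 * D.g j)⁻¹ * (c i t j - a j) ^ 2)
        (fun i _ => Finset.sum_nonneg fun j _ => hnn i j) (Finset.mem_univ i))
    unfold lyapunov at h1
    have h5 : (2 * D.g j)⁻¹ * (c i t j - a j) ^ 2 ≤ lyapunov D a p c 0 + D.k₂ / 2 * B := by
      unfold lyapunov
      linarith
    rw [inv_mul_le_iff₀ (by positivity)] at h5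
    refine abs_le_of_sq_le_sq ?_ (by positivity)
    nlinarith [le_abs_self X, abs_nonneg X]
  choose B' hB' hb using key
  refine ⟨∑ j, B' j + 1, add_pos_of_nonneg_of_pos
    (Finset.sum_nonneg fun j _ => (hB' j).le) one_pos, fun i t j ht => ?_⟩
  have := Finset.single_le_sum (f := B') (fun j _ => (hB' j).le) (Finset.mem_univ j)
  linarith [hb j i t ht]

end ClosedLoop

end Controller

theorem abs_dotProduct_le {n : ℕ} {x y : Fin n → ℝ} (C : ℝ) (h : ∀ i, |x i * y i| ≤ C) :
    |x ⬝ᵥ y| ≤ n * C :=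
  (Finset.abs_sum_le_sum_abs _ _).trans
    ((Finset.sum_le_card_nsmul _ _ C fun i _ => h i).trans_eq (by simp))

/-! ### Lipschitz bounds in time -/

namespace Controller

variable {m N : ℕ} {D : Controller m}

namespace Regular

variable (hD : D.Regular)
include hD

theorem norm_cellIntegral_le {E : Type*} [NormedAddCommGroup E] [NormedSpace ℝ E]
    {f : Plane → E} {C : ℝ} (hC : 0 ≤ C) (hf : ∀ q ∈ D.Q, ‖f q‖ ≤ C) (S : Set Plane) :
    ‖∫ q in S, f q ∂D.area‖ ≤ C * D.area.real univ := by
  have := hD.isFiniteMeasure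
  refine (norm_integral_le_of_norm_le_const (C := C) ?_).trans ?_
  · filter_upwards [ae_restrict_of_ae hD.ae_mem] with q hq using hf q hq
  · rw [measureReal_restrict_apply_univ]
    exact mul_le_mul_of_nonneg_left (measureReal_mono (subset_univ _)) hC

theorem exists_couplingMatrix_bound : ∃ B, 0 < B ∧ ∀ (P : Fin N → Plane) (i : Fin N)
    (j : Fin m) (l : Fin 2), P i ∈ closure D.Q → |D.couplingMatrix P i j l| ≤ B := by
  obtain ⟨B, hB, hK⟩ := hD.exists_basis_bound
  obtain ⟨R, hR, hb⟩ := hD.exists_norm_bound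
  refine ⟨1 * B * (R + R) * D.area.real univ + 1, by positivity, fun P i j l hP => ?_⟩
  rw [couplingMatrix_eq]
  refine (hD.norm_cellIntegral_le (E := ℝ) (C := 1 * B * (R + R)) (by positivity)
    (fun q hq => ?_) _).trans (le_add_of_nonneg_right zero_le_one)
  rw [norm_mul, norm_mul, Real.norm_of_nonneg (sensing_pos _).le]
  have h3 : ‖q l - P i l‖ ≤ R + R :=
    (PiLp.norm_apply_le (q - P i) l).trans ((norm_sub_le _ _).trans
      (add_le_add (hb q (subset_closure hq)) (hb _ hP)))
  have h4 := hK q hq j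
  have h5 := sensing_le_one (D := D) ‖P i - q‖
  rw [← Real.norm_eq_abs] at h4
  gcongr

end Regular

namespace ClosedLoop

variable {a : Fin m → ℝ} {p : Fin N → ℝ → Plane} {θ : Fin N → ℝ → ℝ}
  {v : Fin N → ℝ → EuclideanSpace ℝ (Fin 2)} {L : Fin N → ℝ → Matrix (Fin m) (Fin m) ℝ}
  {l c : Fin N → ℝ → Fin m → ℝ} (h : D.ClosedLoop a p θ v L l c)
include h

omit h in
theorem abs_adaptRate_le {g : ℝ} (x b : Fin m → ℝ) {j : Fin m} (hg : 0 ≤ D.g j) (hj : D.g j ≤ g) :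
    |D.adaptRate x b j| ≤ g * |b j| := by
  rw [adaptRate_apply, abs_mul, abs_of_nonneg hg]
  have : |b j - projectionMatrix D.amin x b j j * b j| ≤ |b j| := by
    simp only [projectionMatrix, Matrix.diagonal_apply_eq]
    split_ifs <;> simp
  exact mul_le_mul hj this (abs_nonneg _) (hg.trans hj)

/-- The projection never enlarges a component of the rate, so although discontinuous the rate is
bounded; absolute continuity integrates this almost-everywhere bound. -/
theorem exists_estimate_lipschitz : ∃ C, 0 < C ∧
    ∀ i s t, 0 ≤ s → 0 ≤ t → ‖c i t - c i s‖ ≤ C * |t - s| := by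
  obtain ⟨B₁, hB₁, h₁⟩ := h.regular.exists_couplingMatrix_bound (N := N)
  obtain ⟨B₂, hB₂, h₂, -⟩ := h.exists_position_lipschitz
  obtain ⟨B₃, hB₃, h₃⟩ := h.exists_filterMatrix_bound
  obtain ⟨B₄, hB₄, h₄⟩ := h.exists_estimate_bound
  have hk₂ := h.k₂_pos
  have hk₃ := h.k₃_pos
  set G := ∑ j, D.g j with hG
  have hG0 : 0 ≤ G := Finset.sum_nonneg fun j _ => (h.g_pos j).le
  have hgG : ∀ j, D.g j ≤ G := fun j =>
    Finset.single_le_sum (fun j _ => (h.g_pos j).le) (Finset.mem_univ j)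
  set C := G * (D.k₂ * (2 * (B₁ * B₂)) + D.k₃ * (m * (B₃ * B₄))) + 1
  have hC : 0 < C := by positivity
  have key : ∀ i j s t, 0 ≤ s → s ≤ t → |c i t j - c i s j| ≤ C * (t - s) := by
    intro i j s t hs hst
    refine absCont_abs_sub_le hst (h.estimate_absCont i j hs hst) ?_
    filter_upwards [h.traj.estimate i j] with r hr hrs
    have hr0 : 0 ≤ r := hs.trans hrs.1.le
    rw [(hr hr0).deriv]
    refine (abs_adaptRate_le _ _ (h.g_pos j).le (hgG j)).trans ?_
    refine le_trans ?_ (le_add_of_nonneg_right zero_le_one)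
    gcongr
    simp only [adaptDir]
    rw [h.velocity_eq i hr0, h.filterVector_eq i hr0, ← Matrix.mulVec_sub]
    refine (abs_sub _ _).trans (add_le_add ?_ ?_)
    · rw [Pi.smul_apply, smul_eq_mul, abs_mul, abs_neg, abs_of_pos hk₂]
      gcongr
      refine (abs_dotProduct_le (B₁ * B₂) fun l => ?_).trans_eq (by simp)
      rw [abs_mul]
      exact mul_le_mul (h₁ _ i j l ((h.mem_closure_and_injective hr0).1 i))
        ((PiLp.norm_apply_le _ l).trans (h₂ i r hr0)) (abs_nonneg _) hB₁.le
    · rw [Pi.smul_apply, smul_eq_mul, abs_mul, abs_of_pos hk₃]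
      gcongr
      refine abs_dotProduct_le (B₃ * B₄) fun k => ?_
      rw [abs_mul]
      exact mul_le_mul (h₃ i r j k hr0) (h₄ i r k hr0) (abs_nonneg _) hB₃.le
  refine ⟨C, hC, fun i s t hs ht => ?_⟩
  rw [pi_norm_le_iff_of_nonneg (by positivity)]
  intro j
  rcases le_total s t with hst | hst
  · rw [abs_of_nonneg (sub_nonneg.2 hst)]
    exact key i j s t hs hst
  · rw [abs_sub_comm, abs_of_nonneg (sub_nonneg.2 hst), Pi.sub_apply, norm_sub_rev]
    exact key i j t s ht hst

theorem exists_filterMatrix_lipschitz : ∃ C, 0 < C ∧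
    ∀ i j k s t, 0 ≤ s → 0 ≤ t → |L i t j k - L i s j k| ≤ C * |t - s| := by
  obtain ⟨B, hB, hL⟩ := h.exists_filterMatrix_bound
  obtain ⟨B', hB', hK⟩ := h.regular.exists_basis_bound
  have hα := h.α_pos
  refine ⟨D.α * B + B' * B', by positivity, fun i j k s t hs ht => ?_⟩
  refine (convex_Ici (0 : ℝ)).norm_image_sub_le_of_norm_hasDerivWithin_le
    (f := fun s => L i s j k) (fun r hr => h.traj.filterMatrix i j k r hr)
    (fun r hr => ?_) hs ht
  have := hK _ (h.position_mem hr i)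
  refine (norm_add_le _ _).trans (add_le_add ?_ ?_)
  · rw [norm_mul, norm_neg, Real.norm_of_nonneg hα.le]
    gcongr
    exact hL i r j k hr
  · rw [norm_mul]
    exact mul_le_mul (this j) (this k) (norm_nonneg _) hB'.le

end ClosedLoop

/-! ### Dissipation near collisions -/

namespace Regular

variable (hD : D.Regular)
include hD

/-- On cells of area at least `A`, the moment of the modified density about a neighbouring site,
in the direction away from that site, is bounded below. -/
theorem exists_moment_lower_bound {A : ℝ} (hA : 0 < A) : ∃ w₀, 0 < w₀ ∧
    ∀ (P : Fin N → Plane) (k k' : Fin N) (c : Fin m → ℝ), k' ≠ k → P k ≠ P k' →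
      P k ∈ closure D.Q → (∀ j, D.amin ≤ c j) → A ≤ D.area.real (nearestRegion P k) →
      w₀ ≤ ∫ q in nearestRegion P k, D.modDensity c (P k) q •
        inner ℝ (‖P k - P k'‖⁻¹ • (P k - P k')) (q - P k') ∂D.area := by
  have := hD.isFiniteMeasure
  -- Two strips are discarded, one through each site, each of area at most A/4, so at least A/2 of
  -- the cell remains.
  obtain ⟨s, hs, hstrip⟩ := exists_strip_volume_le hD.bounded
    (ε := ENNReal.ofReal (A / 4)) (by simpa using hA)
  have hstrip' : ∀ u x : Plane, ‖u‖ = 1 →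
      D.area.real {q | |inner ℝ u (q - x)| ≤ s} ≤ A / 4 := by
    intro u x hu
    have hm : MeasurableSet {q : Plane | |inner ℝ u (q - x)| ≤ s} :=
      (isClosed_le (by fun_prop) continuous_const).measurableSet
    rw [measureReal_def, Measure.restrict_apply hm, inter_comm]
    exact ENNReal.toReal_le_of_le_ofReal (by positivity) (hstrip u x hu)
  obtain ⟨R, hR, hb⟩ := hD.exists_norm_bound
  have hγ := hD.γ_pos
  have hes : D.sensing s < 1 := hD.sensing_lt_one hs.ne'
  have heR := sensing_pos (D := D) (R + R)
  -- A lower bound for the modified density at distances between s and 2R from the site: off the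
  -- strip through P k the distance exceeds s, and 2R bounds it from above.
  set κ := D.γ * (D.sensing (R + R) * (1 - D.sensing s)) with hκ
  have hκ0 : 0 < κ := mul_pos hγ (mul_pos heR (by linarith))
  refine ⟨κ * s * (A / 2), by positivity, fun P k k' c hkk hne hP hc hcell => ?_⟩
  set u := ‖P k - P k'‖⁻¹ • (P k - P k') with hu
  have hd : 0 < ‖P k - P k'‖ := norm_pos_iff.2 (sub_ne_zero.2 hne)
  have hu1 : ‖u‖ = 1 := by
    rw [hu, norm_smul, norm_inv, norm_norm, inv_mul_cancel₀ hd.ne']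
  set f : Plane → ℝ := fun q => D.modDensity c (P k) q • inner ℝ u (q - P k') with hf
  have hfi : Integrable f D.area := hD.integrable_modDensity_smul c (P k) (by fun_prop)
  have hpos : ∀ q ∈ nearestRegion P k, 0 ≤ inner ℝ u (q - P k') := by
    intro q hq
    have h1 := inner_midpoint_nonneg hkk hq
    rw [hu, inner_smul_left]
    simp only [conj_trivial]
    have : 0 ≤ inner ℝ (P k - P k') (q - P k') := by nlinarith [sq_nonneg ‖P k - P k'‖]
    positivity
  set S₁ : Set Plane := {q | |inner ℝ u (q - P k')| ≤ s}
  set S₂ : Set Plane := {q | |inner ℝ u (q - P k)| ≤ s}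
  have hS₁ : MeasurableSet S₁ := (isClosed_le (by fun_prop) continuous_const).measurableSet
  have hS₂ : MeasurableSet S₂ := (isClosed_le (by fun_prop) continuous_const).measurableSet
  set G := nearestRegion P k \ (S₁ ∪ S₂) with hG
  have hGm : MeasurableSet G := (measurableSet_nearestRegion P k).diff (hS₁.union hS₂)
  have hGA : A / 2 ≤ D.area.real G := by
    have h1 : D.area.real (nearestRegion P k) ≤
        D.area.real G + (D.area.real S₁ + D.area.real S₂) := by
      refine (measureReal_mono (s₂ := G ∪ (S₁ ∪ S₂)) ?_ (measure_ne_top _ _)).trans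
        ((measureReal_union_le _ _).trans (add_le_add_right (measureReal_union_le _ _) _))
      intro q hq
      by_cases h : q ∈ S₁ ∪ S₂
      · exact Or.inr h
      · exact Or.inl ⟨hq, h⟩
    have h2 := hstrip' u (P k') hu1
    have h3 := hstrip' u (P k) hu1
    linarith
  have hfG : ∀ q ∈ G, q ∈ D.Q → κ * s ≤ f q := by
    intro q hq hqQ
    have hq1 : s < inner ℝ u (q - P k') := by
      have : q ∉ S₁ := fun h => hq.2 (Or.inl h)
      simp only [S₁, mem_ofPred_eq, not_le] at this
      rwa [abs_of_nonneg (hpos q hq.1)] at this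
    have hq2 : s < ‖P k - q‖ := by
      have : q ∉ S₂ := fun h => hq.2 (Or.inr h)
      simp only [S₂, mem_ofPred_eq, not_le] at this
      have h2 := abs_real_inner_le_norm u (q - P k)
      rw [hu1, one_mul, norm_sub_rev] at h2
      linarith
    have hq3 : ‖P k - q‖ ≤ R + R :=
      (norm_sub_le _ _).trans (add_le_add (hb _ hP) (hb q (subset_closure hqQ)))
    have hmono : ∀ x y, 0 ≤ x → x ≤ y → D.sensing y ≤ D.sensing x := by
      intro x y hx hxy
      unfold sensing
      gcongr
    have h4 := hmono _ _ (norm_nonneg _) hq3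
    have h5 := hmono _ _ hs.le hq2.le
    have h6 : κ ≤ D.modDensity c (P k) q := by
      refine le_trans ?_ (hD.le_modDensity hc (P k) hqQ)
      rw [hκ]
      gcongr
      linarith
    exact mul_le_mul h6 hq1.le hs.le (hκ0.le.trans h6)
  calc κ * s * (A / 2) ≤ κ * s * D.area.real G := by gcongr
    _ = ∫ q in G, κ * s ∂D.area := by rw [setIntegral_const, smul_eq_mul, mul_comm]
    _ ≤ ∫ q in G, f q ∂D.area := by
      refine setIntegral_mono_ae_restrict (integrable_const _) hfi.integrableOn ?_
      filter_upwards [ae_restrict_of_ae hD.ae_mem, ae_restrict_mem hGm] with q hq hqG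
      exact hfG q hqG hq
    _ ≤ ∫ q in nearestRegion P k, f q ∂D.area := by
      refine setIntegral_mono_set hfi.integrableOn ?_ (Eventually.of_forall sdiff_subset)
      filter_upwards [ae_restrict_of_ae hD.ae_mem,
        ae_restrict_mem (measurableSet_nearestRegion P k)] with q hq hqk
      exact mul_nonneg (hD.modDensity_nonneg hc _ hq) (hpos q hqk)

theorem exists_mass_bound (B : ℝ) : ∃ M, 0 < M ∧ ∀ (P : Fin N → Plane) (c : Fin m → ℝ) (i : Fin N),
    ‖c‖ ≤ B → D.mass P c i ≤ M := by
  obtain ⟨C, hC, hb⟩ := hD.exists_modDensity_bound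
  refine ⟨C * (|B| + 1) * D.area.real univ + 1, by positivity, fun P c i hc => ?_⟩
  rw [mass_eq]
  refine (le_abs_self _).trans ((hD.norm_cellIntegral_le (E := ℝ) (C := C * (|B| + 1))
    (by positivity) (fun q hq => (hb c (P i) q hq).trans ?_) _).trans
    (le_add_of_nonneg_right zero_le_one))
  gcongr
  exact hc.trans (le_abs_self B)

/-- Near a colliding configuration, some robot of the cluster has a large cell with a centroid
away from the cluster. -/
theorem exists_collision_bound (B : ℝ) {P₀ : Fin N → Plane} (hP₀ : ∀ i, P₀ i ∈ closure D.Q)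
    {i₀ j₀ : Fin N} (hij : i₀ ≠ j₀) (heq : P₀ i₀ = P₀ j₀) :
    ∃ κ, 0 < κ ∧ ∀ᶠ P in 𝓝 P₀, Function.Injective P → (∀ i, P i ∈ closure D.Q) →
      ∀ c : Fin N → Fin m → ℝ, (∀ i j, D.amin ≤ c i j) → (∀ i, ‖c i‖ ≤ B) →
        ∃ k, κ ≤ D.mass P (c k) k * ‖P k - D.centroid P (c k) k‖ ^ 2 := by
  classical
  have := hD.isFiniteMeasure
  set x := P₀ i₀
  -- Sites outside the cluster at x are at distance at least 4r, so after a perturbation below r/2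
  -- the ball of radius r is covered by the cells of the cluster alone.
  obtain ⟨r, hr, hfar⟩ : ∃ r : ℝ, 0 < r ∧ ∀ k, P₀ k ≠ x → 4 * r ≤ ‖P₀ k - x‖ := by
    have hev : ∀ᶠ r : ℝ in 𝓝[>] 0, ∀ k, P₀ k ≠ x → 4 * r ≤ ‖P₀ k - x‖ := by
      rw [eventually_all]
      intro k
      by_cases hk : P₀ k = x
      · simp [hk]
      · have h0 : 0 < ‖P₀ k - x‖ / 4 := by
          have := norm_pos_iff.2 (sub_ne_zero.2 hk)
          positivity
        filter_upwards [Ioo_mem_nhdsGT h0] with r hr _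
        linarith [hr.2]
    obtain ⟨r, hr, hr'⟩ := (hev.and self_mem_nhdsWithin).exists
    exact ⟨r, hr', hr⟩
  set A₀ := D.area.real (Metric.ball x r) with hA₀
  have hA₀pos : 0 < A₀ := by
    obtain ⟨q, hq, hqb⟩ := hD.exists_mem_interior (hP₀ i₀) Metric.isOpen_ball
      (Metric.mem_ball_self hr)
    rw [hA₀, measureReal_def, Measure.restrict_apply Metric.isOpen_ball.measurableSet]
    refine ENNReal.toReal_pos (ne_of_gt ?_) ?_
    · exact ((Metric.isOpen_ball.inter isOpen_interior).measure_pos volume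
        ⟨q, hqb, hq⟩).trans_le (measure_mono (inter_subset_inter_right _ interior_subset))
    · exact ((measure_mono inter_subset_right).trans_lt hD.bounded.measure_lt_top).ne
  have hN : (0 : ℝ) < N := by
    have := i₀.pos
    exact_mod_cast this
  obtain ⟨w₀, hw₀, hw⟩ := hD.exists_moment_lower_bound (N := N) (div_pos hA₀pos hN)
  obtain ⟨M, hM, hmass⟩ := hD.exists_mass_bound (N := N) B
  -- The bound r/2 serves the covering; w₀/(4M) makes the error M · 2ε from the distance between the
  -- two cluster sites at most w₀/2.
  set ε := min (r / 2) (w₀ / (4 * M)) with hε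
  have hε0 : 0 < ε := by positivity
  -- With mass μ ≤ M and displacement ρ, the moment bound gives μρ ≥ w₀/2, hence μρ² = (μρ)²/μ ≥
  -- (w₀/2)²/M.
  refine ⟨(w₀ / 2) ^ 2 / M, by positivity, ?_⟩
  filter_upwards [Metric.ball_mem_nhds P₀ hε0] with P hP hinj hmem c hc hcB
  have hPk : ∀ k, ‖P k - P₀ k‖ < ε := fun k => by
    have h1 : ‖P - P₀‖ < ε := by rwa [← dist_eq_norm]
    exact (norm_le_pi_norm (P - P₀) k).trans_lt h1
  have hεr : ε ≤ r / 2 := min_le_left _ _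
  set I : Finset (Fin N) := Finset.univ.filter fun k => P₀ k = x with hI
  have hcover : Metric.ball x r ⊆ ⋃ k ∈ I, nearestRegion P k := by
    intro q hq
    rw [mem_ball_iff_norm] at hq
    obtain ⟨k, hk⟩ := exists_mem_nearestRegion P i₀ q
    have hkI : P₀ k = x := by
      by_contra hne
      have h1 := hfar k hne
      have h2 : ‖q - P k‖ ≤ ‖q - P i₀‖ := by
        by_cases h : i₀ = k
        · rw [h]
        · exact hk i₀ h
      have h3 : ‖q - P i₀‖ ≤ ‖q - x‖ + ‖P i₀ - P₀ i₀‖ := by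
        have : q - P i₀ = (q - x) - (P i₀ - P₀ i₀) := by simp only [x]; abel
        rw [this]; exact norm_sub_le _ _
      have h4 : ‖P₀ k - x‖ ≤ ‖q - x‖ + ‖q - P k‖ + ‖P k - P₀ k‖ := by
        have : P₀ k - x = (q - x) - (q - P k) - (P k - P₀ k) := by abel
        rw [this]
        exact (norm_sub_le _ _).trans (add_le_add_left (norm_sub_le _ _) _)
      linarith [hPk k, hPk i₀]
    exact mem_biUnion (by simpa [hI] using hkI) hk
  have hI0 : i₀ ∈ I := by simp [hI, x]
  -- Pigeonhole: at most N cluster cells cover a ball whose part in the region has area A₀.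
  obtain ⟨k, hkI, hkA⟩ : ∃ k ∈ I, A₀ / N ≤ D.area.real (nearestRegion P k) := by
    by_contra! hcon
    have h1 : A₀ ≤ ∑ k ∈ I, D.area.real (nearestRegion P k) :=
      (measureReal_mono hcover (measure_ne_top _ _)).trans (measureReal_biUnion_finset_le _ _)
    have h2 := Finset.sum_lt_sum_of_nonempty ⟨i₀, hI0⟩ hcon
    rw [Finset.sum_const, nsmul_eq_mul] at h2
    have h3 : (I.card : ℝ) ≤ N := by
      have := Finset.card_le_univ I
      rw [Fintype.card_fin] at this
      exact_mod_cast this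
    have h4 : (I.card : ℝ) * (A₀ / N) ≤ N * (A₀ / N) := by gcongr
    rw [mul_div_cancel₀ _ hN.ne'] at h4
    linarith
  obtain ⟨k', hk'I, hk'⟩ : ∃ k' ∈ I, k' ≠ k := by
    by_cases h : i₀ = k
    · exact ⟨j₀, by simp [hI, ← heq, x], fun h' => hij (h.trans h'.symm)⟩
    · exact ⟨i₀, hI0, h⟩
  refine ⟨k, ?_⟩
  have hkx : P₀ k = x := by simpa [hI] using hkI
  have hk'x : P₀ k' = x := by simpa [hI] using hk'I
  have hne : P k ≠ P k' := hinj.ne hk'.symm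
  have hclose : ‖P k - P k'‖ ≤ 2 * ε := by
    have : P k - P k' = (P k - P₀ k) - (P k' - P₀ k') := by rw [hkx, hk'x]; abel
    rw [this]
    linarith [norm_sub_le (P k - P₀ k) (P k' - P₀ k'), hPk k, hPk k']
  have hlow := hw P k k' (c k) hk' hne (hmem k) (hc k) hkA
  set u := ‖P k - P k'‖⁻¹ • (P k - P k') with hu
  have hd : 0 < ‖P k - P k'‖ := norm_pos_iff.2 (sub_ne_zero.2 hne)
  have hu1 : ‖u‖ = 1 := by
    rw [hu, norm_smul, norm_inv, norm_norm, inv_mul_cancel₀ hd.ne']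
  have hA : 0 < D.area (nearestRegion P k) := by
    by_contra hcon
    have h0 : D.area (nearestRegion P k) = 0 := by simpa using hcon
    rw [measureReal_def, h0] at hkA
    have := div_pos hA₀pos hN
    simp only [ENNReal.toReal_zero] at hkA
    linarith
  have hm := hD.mass_pos hA (hc k)
  have hmM := hmass P (c k) k (hcB k)
  have hfun := hD.mass_mul_sub_centroid hm.ne' (-(innerSL ℝ u)) (-(inner ℝ u (P k')))
  have hint : ∀ q : Plane, -(inner ℝ u (P k')) - (-(innerSL ℝ u)) q = inner ℝ u (q - P k') := by
    intro q
    simp only [neg_apply, innerSL_apply_apply, inner_sub_right]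
    ring
  simp only [hint] at hfun
  rw [← hfun] at hlow
  have hsplit : inner ℝ u (D.centroid P (c k) k - P k') ≤
      ‖P k - D.centroid P (c k) k‖ + 2 * ε := by
    have h1 := real_inner_le_norm u (D.centroid P (c k) k - P k')
    rw [hu1, one_mul] at h1
    refine h1.trans ?_
    have h2 : D.centroid P (c k) k - P k' =
        (P k - P k') - (P k - D.centroid P (c k) k) := by abel
    rw [h2]
    linarith [norm_sub_le (P k - P k') (P k - D.centroid P (c k) k)]
  have hMε : M * (2 * ε) ≤ w₀ / 2 := by
    have : ε ≤ w₀ / (4 * M) := min_le_right _ _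
    calc M * (2 * ε) ≤ M * (2 * (w₀ / (4 * M))) := by gcongr
      _ = w₀ / 2 := by field_simp; norm_num
  set μ := D.mass P (c k) k
  set ρ := ‖P k - D.centroid P (c k) k‖
  have h1 : w₀ / 2 ≤ μ * ρ := by
    have h2 : w₀ ≤ μ * (ρ + 2 * ε) := hlow.trans (by gcongr)
    have h3 : μ * (2 * ε) ≤ M * (2 * ε) := by gcongr
    linarith
  rw [div_le_iff₀ hM]
  calc (w₀ / 2) ^ 2 ≤ (μ * ρ) ^ 2 := by gcongr
    _ = μ * ρ ^ 2 * μ := by ring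
    _ ≤ μ * ρ ^ 2 * M := by gcongr

end Regular

end Controller

/-! ### Asymptotic non-collision and the limits -/

/-- A form of Barbalat's lemma with recurrence of small values in place of integrability, matching
what `exists_forall_exists_dissipation_lt` supplies. -/
theorem tendsto_zero_of_uniformContinuousOn {f : ℝ → ℝ} {s : ℝ} (hf0 : ∀ t, s ≤ t → 0 ≤ f t)
    (hf : UniformContinuousOn f (Ici s))
    (h : ∀ η ε : ℝ, 0 < η → 0 < ε → ∃ t₁, ∀ t, t₁ ≤ t → ∃ r ∈ Ioo t (t + η), f r < ε) :
    Tendsto f atTop (𝓝 0) := by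
  rw [Metric.tendsto_atTop]
  intro ε hε
  obtain ⟨η, hη, hu⟩ := Metric.uniformContinuousOn_iff.1 hf (ε / 2) (by positivity)
  obtain ⟨t₁, ht₁⟩ := h η (ε / 2) hη (by positivity)
  refine ⟨max s t₁, fun t ht => ?_⟩
  have hst : s ≤ t := (le_max_left _ _).trans ht
  obtain ⟨r, hr, hfr⟩ := ht₁ t ((le_max_right _ _).trans ht)
  have h1 := hu t hst r (hst.trans hr.1.le) (by
    rw [Real.dist_eq, abs_sub_lt_iff]
    constructor <;> linarith [hr.1, hr.2])
  rw [Real.dist_eq] at h1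
  rw [Real.dist_eq, sub_zero, abs_of_nonneg (hf0 t hst)]
  linarith [(abs_sub_lt_iff.1 h1).1]

theorem uniformContinuousOn_comp_of_lipschitz {X Y : Type*} [PseudoMetricSpace X]
    [PseudoMetricSpace Y] {x : ℝ → X} {g : X → Y} {F : Set X} {s C : ℝ} (hF : IsCompact F)
    (hg : ContinuousOn g F) (hx : ∀ t, s ≤ t → x t ∈ F) (hC : 0 < C)
    (hlip : ∀ r t, s ≤ r → s ≤ t → dist (x r) (x t) ≤ C * dist r t) :
    UniformContinuousOn (fun t => g (x t)) (Ici s) := by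
  refine (hF.uniformContinuousOn_of_continuous hg).comp
    (LipschitzOnWith.uniformContinuousOn (K := C.toNNReal) ?_) fun t ht => hx t ht
  refine LipschitzOnWith.of_dist_le_mul fun r hr t ht => ?_
  rw [Real.coe_toNNReal _ hC.le]
  exact hlip r t hr ht

theorem isOpen_injective {N : ℕ} : IsOpen {P : Fin N → Plane | Function.Injective P} := by
  have : {P : Fin N → Plane | Function.Injective P} =
      ⋂ i, ⋂ j, ⋂ (_ : i ≠ j), {P | P i ≠ P j} := by
    ext P
    simp only [mem_ofPred_eq, mem_iInter, Function.Injective]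
    exact forall_congr' fun i => forall_congr' fun j => not_imp_not.symm
  rw [this]
  exact isOpen_iInter_of_finite fun i => isOpen_iInter_of_finite fun j =>
    isOpen_iInter_of_finite fun _ => isOpen_ne_fun (continuous_apply i) (continuous_apply j)

namespace Controller

variable {m N : ℕ} {D : Controller m}

namespace Regular

variable (hD : D.Regular)
include hD

theorem continuousAt_weighted_cellIntegral {E : Type*} [NormedAddCommGroup E] [NormedSpace ℝ E]
    {g : Plane → E} (hg : Continuous g) {z₀ : (Fin N → Plane) × (Fin m → ℝ)}
    (hinj : Function.Injective z₀.1) (i : Fin N) :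
    ContinuousAt (fun z : (Fin N → Plane) × (Fin m → ℝ) =>
      ∫ q in nearestRegion z.1 i, D.modDensity z.2 (z.1 i) q • g q ∂D.area) z₀ := by
  obtain ⟨B, hB, hb⟩ := hD.exists_modDensity_bound
  obtain ⟨C, hC⟩ := hD.bounded.isCompact_closure.exists_bound_of_continuousOn hg.continuousOn
  have hP : ContinuousAt (fun z : (Fin N → Plane) × (Fin m → ℝ) => z.1) z₀ := continuousAt_fst
  refine hD.continuousAt_cellIntegral (C := B * (‖z₀.2‖ + 1 + 1) * C)
    (P := fun z : (Fin N → Plane) × (Fin m → ℝ) => z.1)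
    (f := fun z q => D.modDensity z.2 (z.1 i) q • g q) hP hinj
    (fun z => (hD.continuousOn_modDensity z.2 (z.1 i)).smul hg.continuousOn) ?_ (fun q _ => ?_) i
  · have h1 : ∀ᶠ z : (Fin N → Plane) × (Fin m → ℝ) in 𝓝 z₀, ‖z.2‖ < ‖z₀.2‖ + 1 :=
      continuousAt_snd.norm.eventually_lt continuousAt_const (by linarith)
    filter_upwards [h1] with z hz q hq
    rw [norm_smul]
    refine mul_le_mul ((hb _ _ q hq).trans ?_) (hC q (subset_closure hq)) (norm_nonneg _)
      (by positivity)
    gcongr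
  · have h1 : Continuous fun z : (Fin N → Plane) × (Fin m → ℝ) => D.sensing ‖z.1 i - q‖ :=
      continuous_sensing.comp (by fun_prop)
    have h2 : Continuous fun z : (Fin N → Plane) × (Fin m → ℝ) => D.density z.2 q := by
      unfold density dotProduct
      fun_prop
    exact ((h1.mul (h2.sub (continuous_const.mul h1))).smul continuous_const).continuousAt

theorem continuousAt_mass {z₀ : (Fin N → Plane) × (Fin m → ℝ)}
    (hinj : Function.Injective z₀.1) (i : Fin N) :
    ContinuousAt (fun z : (Fin N → Plane) × (Fin m → ℝ) => D.mass z.1 z.2 i) z₀ := by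
  have := hD.continuousAt_weighted_cellIntegral (g := fun _ => (1 : ℝ)) continuous_const hinj i
  simpa only [smul_eq_mul, mul_one, ← mass_eq] using this

theorem continuousAt_moment {z₀ : (Fin N → Plane) × (Fin m → ℝ)}
    (hinj : Function.Injective z₀.1) (i : Fin N) :
    ContinuousAt (fun z : (Fin N → Plane) × (Fin m → ℝ) => D.moment z.1 z.2 i) z₀ := by
  have := hD.continuousAt_weighted_cellIntegral continuous_id hinj i
  simpa only [id, ← moment_eq] using this

end Regular

namespace ClosedLoop

variable {a : Fin m → ℝ} {p : Fin N → ℝ → Plane} {θ : Fin N → ℝ → ℝ}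
  {v : Fin N → ℝ → EuclideanSpace ℝ (Fin 2)} {L : Fin N → ℝ → Matrix (Fin m) (Fin m) ℝ}
  {l c : Fin N → ℝ → Fin m → ℝ} (h : D.ClosedLoop a p θ v L l c)
include h

theorem exists_norm_estimate_bound : ∃ B, 0 < B ∧ ∀ i t, 0 ≤ t → ‖c i t‖ ≤ B := by
  obtain ⟨B, hB, hb⟩ := h.exists_estimate_bound
  refine ⟨B + ‖a‖, by positivity, fun i t ht => ?_⟩
  have h1 : ‖c i t - a‖ ≤ B := (pi_norm_le_iff_of_nonneg hB.le).2 fun j => hb i t j ht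
  have h2 : c i t = (c i t - a) + a := by abel
  rw [h2]
  exact (norm_add_le _ _).trans (by linarith)

theorem mul_mass_le_dissipation (i : Fin N) {t : ℝ} (ht : 0 ≤ t) :
    D.k₁ * D.k₂ * (D.mass (fun k => p k t) (c i t) i *
      ‖p i t - D.centroid (fun k => p k t) (c i t) i‖ ^ 2) ≤ dissipation D a p L c i t :=
  le_add_of_nonneg_right (mul_nonneg h.k₃_pos.le (h.quadForm_nonneg i _ ht))

theorem mul_quadForm_le_dissipation (i : Fin N) {t : ℝ} (ht : 0 ≤ t) :
    D.k₃ * ((c i t - a) ⬝ᵥ L i t *ᵥ (c i t - a)) ≤ dissipation D a p L c i t :=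
  le_add_of_nonneg_left (mul_nonneg (mul_nonneg h.k₁_pos.le h.k₂_pos.le)
    (mul_nonneg (h.mass_pos ht i).le (sq_nonneg _)))

/-- The robots do not collide asymptotically. -/
theorem exists_compact_configurations [Nonempty (Fin N)] : ∃ F : Set (Fin N → Plane),
    IsCompact F ∧ (∀ P ∈ F, Function.Injective P ∧ ∀ i, P i ∈ closure D.Q) ∧
      ∃ t₀, 0 ≤ t₀ ∧ ∀ t, t₀ ≤ t → (fun k => p k t) ∈ F := by
  obtain ⟨B, hB, hcB⟩ := h.exists_norm_estimate_bound
  obtain ⟨C, hC, hL⟩ := h.exists_config_lipschitz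
  have hk := mul_pos h.k₁_pos h.k₂_pos
  set X : Set (Fin N → Plane) := {P | ∀ i, P i ∈ closure D.Q} with hX
  have hXc : IsCompact X := by
    have := isCompact_univ_pi fun _ : Fin N => h.regular.bounded.isCompact_closure
    convert this using 1
    ext P
    simp [hX]
  let Φ : ℝ → (Fin N → Plane) → Prop := fun κ P => Function.Injective P → P ∈ X →
    ∀ c : Fin N → Fin m → ℝ, (∀ i j, D.amin ≤ c i j) → (∀ i, ‖c i‖ ≤ B) →
      ∃ k, κ ≤ D.mass P (c k) k * ‖P k - D.centroid P (c k) k‖ ^ 2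
  have hΦ : ∀ κ κ' P, κ ≤ κ' → Φ κ' P → Φ κ P := by
    intro κ κ' P hle hP hinj hPX c hc hcB
    obtain ⟨k, hk⟩ := hP hinj hPX c hc hcB
    exact ⟨k, hle.trans hk⟩
  have hZ : IsCompact (X \ {P : Fin N → Plane | Function.Injective P}) :=
    hXc.diff isOpen_injective
  obtain ⟨κ, hκ, hev⟩ : ∃ κ, 0 < κ ∧
      ∀ᶠ P in 𝓝ˢ (X \ {P : Fin N → Plane | Function.Injective P}), Φ κ P := by
    -- Compactness of the colliding configurations makes the local collision bounds uniform: one κ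
    -- works on a neighbourhood of all of them.
    refine hZ.induction_on (p := fun S => ∃ κ, 0 < κ ∧ ∀ᶠ P in 𝓝ˢ S, Φ κ P)
      ⟨1, one_pos, by simp⟩ ?_ ?_ ?_
    · rintro S T hST ⟨κ, hκ, hev⟩
      exact ⟨κ, hκ, hev.filter_mono (nhdsSet_mono hST)⟩
    · rintro S T ⟨κ, hκ, hev⟩ ⟨κ', hκ', hev'⟩
      refine ⟨min κ κ', lt_min hκ hκ', ?_⟩
      rw [nhdsSet_union, eventually_sup]
      exact ⟨hev.mono fun P => hΦ _ _ P (min_le_left _ _),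
        hev'.mono fun P => hΦ _ _ P (min_le_right _ _)⟩
    · rintro P₀ ⟨hP₀, hninj⟩
      simp only [mem_ofPred_eq, Function.Injective, not_forall] at hninj
      obtain ⟨i, j, heq, hij⟩ := hninj
      obtain ⟨κ, hκ, hev⟩ := h.regular.exists_collision_bound B hP₀ hij heq
      obtain ⟨U, hU, hUo, hPU⟩ := eventually_nhds_iff.1 hev
      exact ⟨U, mem_nhdsWithin_of_mem_nhds (hUo.mem_nhds hPU), κ, hκ,
        eventually_nhdsSet_iff_exists.2 ⟨U, hUo, subset_rfl, hU⟩⟩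
  obtain ⟨U, hUo, hZU, hU⟩ := eventually_nhdsSet_iff_exists.1 hev
  have hF₀ : IsCompact (X \ U) := hXc.diff hUo
  have hF₀inj : X \ U ⊆ {P | Function.Injective P} := by
    intro P hP
    by_contra hcon
    exact hP.2 (hZU ⟨hP.1, hcon⟩)
  -- Outside U configurations are injective and form a compact set, so a margin δ is available
  -- before injectivity can fail.
  obtain ⟨δ, hδ, hthick⟩ := hF₀.exists_cthickening_subset_open isOpen_injective hF₀inj
  refine ⟨X ∩ Metric.cthickening δ (X \ U), hXc.inter_right Metric.isClosed_cthickening,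
    fun P hP => ⟨hthick hP.2, hP.1⟩, ?_⟩
  -- Each late window of length δ/C contains a time with dissipation too small for U; at speed at
  -- most C the configuration at t is within δ of that one.
  obtain ⟨t₀, ht₀, hdis⟩ := h.exists_forall_exists_dissipation_lt (η := δ / C)
    (κ := D.k₁ * D.k₂ * κ) (by positivity) (by positivity)
  refine ⟨t₀, ht₀, fun t ht => ⟨(h.mem_closure_and_injective (ht₀.trans ht)).1, ?_⟩⟩
  obtain ⟨r, hr, hlt⟩ := hdis t ht
  have ht0 := ht₀.trans ht
  have hr0 := ht0.trans hr.1.le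
  have hrX := h.mem_closure_and_injective hr0
  refine Metric.mem_cthickening_of_dist_le _ (fun k => p k r) _ _ ⟨hrX.1, fun hrU => ?_⟩ ?_
  · obtain ⟨k, hk'⟩ := hU _ hrU hrX.2 hrX.1 (fun k => c k r)
      (fun i j => h.amin_le_estimate i hr0 j) (fun i => hcB i r hr0)
    have h1 := h.mul_mass_le_dissipation k hr0
    have h2 := mul_le_mul_of_nonneg_left hk' hk.le
    exact absurd (hlt k) (not_lt.2 (h2.trans h1))
  · rw [dist_eq_norm]
    refine (hL r t hr0 ht0).trans ?_
    have : |t - r| ≤ δ / C := by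
      rw [abs_sub_comm, abs_of_pos (sub_pos.2 hr.1)]
      linarith [hr.2]
    calc C * |t - r| ≤ C * (δ / C) := by gcongr
      _ = δ := by field_simp

/-- On the compact set of injective configurations and admissible bounded estimates the mass has a
positive minimum μ and the displacement is continuous. Small dissipation then forces small
displacement, and uniform continuity in time fills the gaps. -/
theorem tendsto_position_sub_centroid (i : Fin N) :
    Tendsto (fun t => ‖p i t - D.centroid (fun k => p k t) (c i t) i‖) atTop (𝓝 0) := by
  have : Nonempty (Fin N) := ⟨i⟩
  obtain ⟨F, hF, hFP, t₀, ht₀, htF⟩ := h.exists_compact_configurations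
  obtain ⟨B, hB, hcB⟩ := h.exists_norm_estimate_bound
  obtain ⟨C₁, hC₁, hL₁⟩ := h.exists_config_lipschitz
  obtain ⟨C₂, hC₂, hL₂⟩ := h.exists_estimate_lipschitz
  set A : Set (Fin m → ℝ) := {x | ∀ j, D.amin ≤ x j} ∩ Metric.closedBall 0 B with hA
  have hAc : IsCompact A := by
    refine (isCompact_closedBall 0 B).inter_left ?_
    simp only [ofPred_forall]
    exact isClosed_iInter fun j => isClosed_le continuous_const (continuous_apply j)
  set x : ℝ → (Fin N → Plane) × (Fin m → ℝ) := fun t => (fun k => p k t, c i t) with hx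
  have hxF : ∀ t, t₀ ≤ t → x t ∈ F ×ˢ A := fun t ht =>
    ⟨htF t ht, fun j => h.amin_le_estimate i (ht₀.trans ht) j, by
      simpa using hcB i t (ht₀.trans ht)⟩
  have hmass_pos : ∀ z ∈ F ×ˢ A, 0 < D.mass z.1 z.2 i := fun z hz =>
    h.regular.mass_pos (h.regular.area_pos (hFP _ hz.1).2 (hFP _ hz.1).1 i) hz.2.1
  have hmass_cont : ContinuousOn
      (fun z : (Fin N → Plane) × (Fin m → ℝ) => D.mass z.1 z.2 i) (F ×ˢ A) := fun z hz =>
    (h.regular.continuousAt_mass (z₀ := z) (hFP _ hz.1).1 i).continuousWithinAt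
  have hmoment_cont : ContinuousOn
      (fun z : (Fin N → Plane) × (Fin m → ℝ) => D.moment z.1 z.2 i) (F ×ˢ A) := fun z hz =>
    (h.regular.continuousAt_moment (z₀ := z) (hFP _ hz.1).1 i).continuousWithinAt
  obtain ⟨z₀, hz₀, hmin⟩ := (hF.prod hAc).exists_isMinOn ⟨x t₀, hxF t₀ le_rfl⟩ hmass_cont
  set μ := D.mass z₀.1 z₀.2 i
  have hμ : 0 < μ := hmass_pos z₀ hz₀
  have hcont : ContinuousOn (fun z : (Fin N → Plane) × (Fin m → ℝ) =>
      ‖z.1 i - D.centroid z.1 z.2 i‖) (F ×ˢ A) := by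
    refine (ContinuousOn.sub (by fun_prop) ?_).norm
    exact (hmass_cont.inv₀ fun z hz => (hmass_pos z hz).ne').smul hmoment_cont
  have hlip : ∀ r t, t₀ ≤ r → t₀ ≤ t → dist (x r) (x t) ≤ max C₁ C₂ * dist r t := by
      intro r t hr ht
      rw [Prod.dist_eq, dist_eq_norm, dist_eq_norm, Real.dist_eq]
      refine max_le ((hL₁ t r (ht₀.trans ht) (ht₀.trans hr)).trans ?_)
        ((hL₂ i t r (ht₀.trans ht) (ht₀.trans hr)).trans ?_)
      · gcongr; exact le_max_left _ _
      · gcongr; exact le_max_right _ _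
  have hunif : UniformContinuousOn
      (fun t => ‖p i t - D.centroid (fun k => p k t) (c i t) i‖) (Ici t₀) :=
    uniformContinuousOn_comp_of_lipschitz (x := x) (hF.prod hAc) hcont hxF
      (lt_max_of_lt_left hC₁) hlip
  refine tendsto_zero_of_uniformContinuousOn (s := t₀) (fun t _ => norm_nonneg _) hunif fun η ε hη hε => ?_
  have hk := mul_pos h.k₁_pos h.k₂_pos
  obtain ⟨t₁, ht₁, hdis⟩ := h.exists_forall_exists_dissipation_lt (η := η)
    (κ := D.k₁ * D.k₂ * (μ * ε ^ 2)) hη (by positivity)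
  refine ⟨max t₀ t₁, fun t ht => ?_⟩
  obtain ⟨r, hr, hlt⟩ := hdis t ((le_max_right _ _).trans ht)
  refine ⟨r, hr, ?_⟩
  have hr0 : t₀ ≤ r := ((le_max_left _ _).trans ht).trans hr.1.le
  have h1 := (h.mul_mass_le_dissipation i (ht₀.trans hr0)).trans_lt (hlt i)
  have h2 := lt_of_mul_lt_mul_left h1 hk.le
  have h3 : μ ≤ D.mass (fun k => p k r) (c i r) i := isMinOn_iff.1 hmin (x r) (hxF r hr0)
  have h4 : μ * ‖p i r - D.centroid (fun k => p k r) (c i r) i‖ ^ 2 < μ * ε ^ 2 :=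
    lt_of_le_of_lt (by gcongr) h2
  exact lt_of_pow_lt_pow_left₀ 2 hε.le (lt_of_mul_lt_mul_left h4 hμ.le)

/-- The same argument, but the form is polynomial in bounded Lipschitz quantities, so the exclusion
of asymptotic collisions is not needed. -/
theorem tendsto_quadForm (i : Fin N) :
    Tendsto (fun t => (c i t - a) ⬝ᵥ L i t *ᵥ (c i t - a)) atTop (𝓝 0) := by
  have : Nonempty (Fin N) := ⟨i⟩
  obtain ⟨B, hB, hcB⟩ := h.exists_norm_estimate_bound
  obtain ⟨B', hB', hLB⟩ := h.exists_filterMatrix_bound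
  obtain ⟨C₁, hC₁, hL₁⟩ := h.exists_estimate_lipschitz
  obtain ⟨C₂, hC₂, hL₂⟩ := h.exists_filterMatrix_lipschitz
  set x : ℝ → (Fin m → ℝ) × (Fin m → Fin m → ℝ) := fun t => (c i t, fun j k => L i t j k) with hx
  set g : (Fin m → ℝ) × (Fin m → Fin m → ℝ) → ℝ :=
    fun z => ∑ j, (z.1 j - a j) * ∑ k, z.2 j k * (z.1 k - a k) with hg
  have hgc : Continuous g := by fun_prop
  have hunif := uniformContinuousOn_comp_of_lipschitz (x := x) (g := g) (s := 0) (C := max C₁ C₂)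
    (F := Metric.closedBall 0 B ×ˢ Metric.closedBall 0 B')
    ((isCompact_closedBall _ _).prod (isCompact_closedBall _ _)) hgc.continuousOn
    (fun t ht => ⟨by simpa using hcB i t ht, by
      rw [mem_closedBall_zero_iff, pi_norm_le_iff_of_nonneg hB'.le]
      intro j
      rw [pi_norm_le_iff_of_nonneg hB'.le]
      exact fun k => hLB i t j k ht⟩)
    (lt_max_of_lt_left hC₁) (fun r t hr ht => by
      rw [Prod.dist_eq, dist_eq_norm, dist_eq_norm, Real.dist_eq]
      refine max_le ((hL₁ i t r ht hr).trans ?_) ?_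
      · gcongr; exact le_max_left _ _
      · have h0 : 0 ≤ max C₁ C₂ * |r - t| :=
          mul_nonneg (hC₁.le.trans (le_max_left _ _)) (abs_nonneg _)
        rw [pi_norm_le_iff_of_nonneg h0]
        intro j
        rw [pi_norm_le_iff_of_nonneg h0]
        intro k
        refine (hL₂ i j k t r ht hr).trans ?_
        gcongr
        exact le_max_right _ _)
  refine tendsto_zero_of_uniformContinuousOn (s := 0)
    (fun t ht => h.quadForm_nonneg i _ ht) hunif fun η ε hη hε => ?_
  have hk := h.k₃_pos
  obtain ⟨t₁, ht₁, hdis⟩ := h.exists_forall_exists_dissipation_lt (η := η)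
    (κ := D.k₃ * ε) hη (by positivity)
  refine ⟨t₁, fun t ht => ?_⟩
  obtain ⟨r, hr, hlt⟩ := hdis t ht
  refine ⟨r, hr, ?_⟩
  have h1 := (h.mul_quadForm_le_dissipation i ((ht₁.trans ht).trans hr.1.le)).trans_lt (hlt i)
  exact lt_of_mul_lt_mul_left h1 hk.le

omit h in
-- The steering matrix is a rotation times diag(1, d), so its inverse expands lengths by at most
-- max(1, 1/d) ≤ 1 + 1/d.
theorem norm_control_le (hd : 0 < D.d) (P : Fin N → Plane) (φ : ℝ) (x : Fin m → ℝ) (i : Fin N) :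
    ‖D.control P φ x i‖ ≤ |D.k₁| * (1 + D.d⁻¹) * ‖P i - D.centroid P x i‖ := by
  set y := P i - D.centroid P x i
  have hinv : (steeringMatrix D.d φ)⁻¹ =
      !![Real.cos φ, Real.sin φ; -(D.d⁻¹ * Real.sin φ), D.d⁻¹ * Real.cos φ] := by
    refine Matrix.inv_eq_right_inv ?_
    have h1 := Real.sin_sq_add_cos_sq φ
    have h2 := hd.ne'
    rw [steeringMatrix]
    ext r s
    fin_cases r <;> fin_cases s <;> simp [Matrix.mul_apply, Fin.sum_univ_two] <;>
      field_simp <;> linarith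
  have hc : D.control P φ x i = -D.k₁ • !₂[Real.cos φ * y 0 + Real.sin φ * y 1,
      D.d⁻¹ * (Real.cos φ * y 1 - Real.sin φ * y 0)] := by
    rw [control, hinv]
    ext r
    fin_cases r
    · simp [y, dotProduct, Fin.sum_univ_two]
    · simp [y, dotProduct, Fin.sum_univ_two]
      left
      ring1
  rw [hc, norm_smul, norm_neg, Real.norm_eq_abs, mul_assoc]
  refine mul_le_mul_of_nonneg_left ?_ (abs_nonneg _)
  have hd' : 0 < D.d⁻¹ := inv_pos.2 hd
  have hrot : (Real.cos φ * y 0 + Real.sin φ * y 1) ^ 2 +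
      (Real.cos φ * y 1 - Real.sin φ * y 0) ^ 2 = ‖y‖ ^ 2 := by
    rw [EuclideanSpace.norm_sq_eq, Fin.sum_univ_two, Real.norm_eq_abs, Real.norm_eq_abs, sq_abs,
      sq_abs]
    linear_combination (y 0 ^ 2 + y 1 ^ 2) * Real.sin_sq_add_cos_sq φ
  refine abs_le_of_sq_le_sq' ?_ (by positivity) |>.2
  rw [EuclideanSpace.norm_sq_eq, Fin.sum_univ_two, Real.norm_eq_abs, Real.norm_eq_abs, sq_abs,
    sq_abs, mul_pow, ← hrot]
  simp only [Matrix.cons_val_zero, Matrix.cons_val_one]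
  nlinarith [sq_nonneg (Real.cos φ * y 0 + Real.sin φ * y 1),
    sq_nonneg (Real.cos φ * y 1 - Real.sin φ * y 0),
    mul_nonneg hd'.le (sq_nonneg (Real.cos φ * y 0 + Real.sin φ * y 1)),
    mul_nonneg (sq_nonneg D.d⁻¹) (sq_nonneg (Real.cos φ * y 0 + Real.sin φ * y 1)),
    mul_nonneg hd'.le (sq_nonneg (Real.cos φ * y 1 - Real.sin φ * y 0))]

theorem tendsto_input (i : Fin N) : Tendsto (fun t => ‖v i t‖) atTop (𝓝 0) := by
  have h1 := (h.tendsto_position_sub_centroid i).const_mul (|D.k₁| * (1 + D.d⁻¹))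
  rw [mul_zero] at h1
  refine squeeze_zero' (Eventually.of_forall fun t => norm_nonneg _) ?_ h1
  filter_upwards [eventually_ge_atTop 0] with t ht
  rw [h.traj.input i t ht]
  exact norm_control_le h.d_pos _ _ _ _

/-- With x = c i t - a frozen, a value at least ε at τ persists as ε/2 on [τ − η, τ] by uniform
continuity of the basis and bounded speed. The filter then keeps xᵀΛ(t)x at least ν, the loss since
τ being at most exp(−αT), against the convergence to zero. -/
theorem exists_forall_abs_density_lt (i : Fin N) {T ε : ℝ} (hT : 0 < T) (hε : 0 < ε) :
    ∃ t₀ : ℝ, ∀ t, t₀ ≤ t → 0 ≤ t - T ∧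
      ∀ τ ∈ Ioo (t - T) t, |D.density (c i t - a) (p i τ)| < ε := by
  obtain ⟨B, hB, hcB⟩ := h.exists_estimate_bound
  obtain ⟨C, hC, -, hL⟩ := h.exists_position_lipschitz
  obtain ⟨δ, hδ, hK⟩ := Metric.uniformContinuousOn_iff.1 h.regular.cont
    (ε / (2 * ((m + 1) * B))) (by positivity)
  have hα := h.α_pos
  set η := δ / (2 * C) with hη
  have hη0 : 0 < η := by positivity
  set κ := (ε / 2) ^ 2
  have hexp : Real.exp (-(D.α * η)) < 1 := Real.exp_lt_one_iff.2 (by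
    have := mul_pos hα hη0
    linarith)
  set ν := Real.exp (-(D.α * T)) * (κ / D.α * (1 - Real.exp (-(D.α * η)))) with hν
  have hν0 : 0 < ν := by
    have : 0 < 1 - Real.exp (-(D.α * η)) := by linarith
    positivity
  obtain ⟨t₁, ht₁⟩ := eventually_atTop.1 ((h.tendsto_quadForm i).eventually_lt_const hν0)
  -- The extra η keeps the interval [τ − η, τ] within nonnegative times.
  refine ⟨max t₁ (T + η), fun t ht => ?_⟩
  have htT : T + η ≤ t := (le_max_right _ _).trans ht
  refine ⟨by linarith, fun τ hτ => ?_⟩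
  by_contra! hcon
  have hτ0 : η ≤ τ := by linarith [hτ.1]
  have hlow := h.quadForm_lower_bound i (c i t - a) (s := τ - η) (r := τ) (t := t) (κ := κ)
    (by linarith) (by linarith) hτ.2.le (fun u hu => by
      have hu0 : 0 ≤ u := by linarith [hu.1]
      have hτ0' : 0 ≤ τ := hη0.le.trans hτ0
      have hdist : dist (p i τ) (p i u) < δ := by
        rw [dist_eq_norm]
        refine (hL i u τ hu0 hτ0').trans_lt ?_
        rw [abs_of_pos (sub_pos.2 hu.2)]
        calc C * (τ - u) ≤ C * η := by gcongr; linarith [hu.1]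
          _ = δ / 2 := by rw [hη]; field_simp
          _ < δ := by linarith
      have h1 := hK _ (h.position_mem hτ0' i) _ (h.position_mem hu0 i) hdist
      rw [dist_eq_norm] at h1
      have h2 : |(D.K (p i τ) - D.K (p i u)) ⬝ᵥ (c i t - a)| ≤ ε / 2 := by
        refine (abs_dotProduct_le (ε / (2 * ((m + 1) * B)) * B) fun j => ?_).trans ?_
        · rw [abs_mul]
          exact mul_le_mul ((norm_le_pi_norm (D.K (p i τ) - D.K (p i u)) j).trans h1.le)
            (hcB i t j (by linarith)) (abs_nonneg _) (by positivity)
        · calc (m : ℝ) * (ε / (2 * ((m + 1) * B)) * B)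
              ≤ (m + 1) * (ε / (2 * ((m + 1) * B)) * B) := by gcongr; linarith
            _ = ε / 2 := by field_simp
      rw [sub_dotProduct] at h2
      have h3 : ε / 2 ≤ |D.density (c i t - a) (p i u)| := by
        have := abs_sub_abs_le_abs_sub (D.density (c i t - a) (p i τ))
          (D.density (c i t - a) (p i u))
        unfold density at this hcon ⊢
        linarith
      rw [← sq_abs (D.density _ _)]
      exact pow_le_pow_left₀ (by positivity) h3 2)
  have h1 := ht₁ t ((le_max_left _ _).trans ht)
  rw [sub_sub_cancel] at hlow
  have h2 : ν ≤ Real.exp (-(D.α * (t - τ))) * (κ / D.α * (1 - Real.exp (-(D.α * η)))) := by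
    rw [hν]
    have h3 : 0 ≤ 1 - Real.exp (-(D.α * η)) := by linarith
    have h4 : t - τ ≤ T := by linarith [hτ.1]
    gcongr
  linarith

end ClosedLoop

end Controller

end AdaptiveCoverage

end

theorem theorem2 {m N : ℕ} (D : AdaptiveCoverage.Controller m) (a : Fin m → ℝ) (β : ℝ)
    (hQ_convex : Convex ℝ D.Q) (hQ_bounded : Bornology.IsBounded D.Q)
    (hQ_interior : (interior D.Q).Nonempty)
    (hK_nonneg : ∀ q ∈ D.Q, ∀ j, 0 ≤ D.K q j) (hK_cont : UniformContinuousOn D.K D.Q)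
    (hamin : 0 < D.amin) (ha : ∀ j, D.amin < a j)
    (hβ : ∀ c : Fin m → ℝ, (∀ j, D.amin ≤ c j) → ∀ q ∈ D.Q, β ≤ D.density c q)
    (hγ : 0 < D.γ) (hγβ : D.γ ≤ β) (hσ : 0 < D.σ) (hd : 0 < D.d)
    (hk₁ : 0 < D.k₁) (hk₂ : 0 < D.k₂) (hk₃ : 0 < D.k₃) (hα : 0 < D.α) (hg : ∀ j, 0 < D.g j)
    (p : Fin N → ℝ → AdaptiveCoverage.Plane) (θ : Fin N → ℝ → ℝ)
    (v : Fin N → ℝ → EuclideanSpace ℝ (Fin 2)) (L : Fin N → ℝ → Matrix (Fin m) (Fin m) ℝ)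
    (l c : Fin N → ℝ → Fin m → ℝ) (htraj : D.IsTrajectory a p θ v L l c)
    (hp_mem : ∀ i, p i 0 ∈ D.Q) (hp_inj : Function.Injective fun i => p i 0)
    (hc_init : ∀ i j, D.amin ≤ c i 0 j) (i : Fin N) :
    Tendsto (fun t => ‖p i t - D.centroid (fun k => p k t) (c i t) i‖) atTop (𝓝 0) ∧
    Tendsto (fun t => ‖v i t‖) atTop (𝓝 0) ∧
    ∀ T : ℝ, 0 < T → ∀ ε : ℝ, 0 < ε → ∃ t₀ : ℝ, ∀ t, t₀ ≤ t → 0 ≤ t - T ∧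
      ∀ τ ∈ Ioo (t - T) t, |D.K (p i τ) ⬝ᵥ (c i t - a)| < ε := by
  have h : D.ClosedLoop a p θ v L l c :=
    { regular :=
        { convex := hQ_convex
          bounded := hQ_bounded
          interior_nonempty := hQ_interior
          cont := hK_cont
          γ_pos := hγ
          σ_pos := hσ
          density_lb := fun x hx q hq => hγβ.trans (hβ x hx q hq) }
      traj := htraj
      amin_lt := ha
      d_pos := hd
      k₁_pos := hk₁
      k₂_pos := hk₂
      k₃_pos := hk₃
      α_pos := hα
      g_pos := hg
      init_mem := hp_mem
      init_inj := hp_inj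
      init_estimate := hc_init }
  exact ⟨h.tendsto_position_sub_centroid i, h.tendsto_input i,
    fun T hT ε hε => h.exists_forall_abs_density_lt i hT hε⟩
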